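/- Let $n\ge 1$, $[n]=\{1,\dots,n\}$, and let $\mathbf S=(S_{i,j})_{1\le i<j\le n}$ be a tuple of finite sets of integers. The $\mathbf S$-braid arrangement $\mathcal A_{\mathbf S}$ is the set of hyperplanes $H_{i,j,s}=\{x\in\mathbb R^n\mid x_i-x_j=s\}$ with $i<j$, $s\in S_{i,j}$; its regions are the connected components of the complement of their union. For $i<j$ put $S_{i,j}^+=\{s>0\mid H_{i,j,s}\in\mathcal A_{\mathbf S}\}$ and $S_{j,i}^+=\{s\ge 0\mid H_{j,i,s}\in\mathcal A_{\mathbf S}\}$ (so $s\in S_{j,i}^+$ iff $s\ge0$ and $-s\in S_{i,j}$), put $S_{i,i}^+=\emptyset$, and let $m=\max\bigcup_{i,j}S_{i,j}^+$ ($m=0$ if the union is empty). Let $\mathrm{Triple}_{\mathbf S}$ be the set of $(i,j,s)$ with $i,j\in[n]$ and $s\in S_{i,j}^+$, or $s=0$ and $i<j$. The arrangement is *transitive* if for all $i,j,k\in[n]$ and integers $s,t\ge 0$, $(i,j,s)\notin\mathrm{Triple}_{\mathbf S}$ and $(j,k,t)\notin\mathrm{Triple}_{\mathbf S}$ imply $(i,k,s+t)\notin\mathrm{Triple}_{\mathbf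 S}$. Suppose that $\mathcal A_{\mathbf S}$ is transitive, or, if $n\ne2$, only that this implication holds for all pairwise distinct $i,j,k$. Then the following are equivalent. (a) The generalized Pak–Stanley labeling $\lambda$ is a bijection from the set of regions of $\mathcal A_{\mathbf S}$ to the set $\mathrm{Park}_{\mathbf S}$. (b) $\mathcal N_{\mathbf S}=\mathcal L_{\mathbf S}=\mathcal M_{\mathbf S}$. (c) Both of the following properties hold. (X) For all $i<j$ in $[n]$, all $k\in[n]\setminus\{i,j\}$ and all $s\in S_{j,k}^+$: $s\in S_{i,k}^+$, or $s=0$ and $i<k$. (Y) For all pairwise distinct $i,j,k\in[n]$ and all integers $s\ge 0$ with $s>0$ or $j<i$: if $s\notin S_{i,j}^+$, then $s+t\notin S_{k,j}^+$ for all $t>0$. (d) $\mathcal A_{\mathbf S}$ is an $(\mathbf m,\varepsilon)$-arrangement: there are integers $m_1,\dots,m_n\ge0$ and $\varepsilon_{i,j}\in\{0,1\}$ ($i\ne j$ in $[n]$), with $\varepsilon_{i,k}\le\varepsilon_{j,k}$ whenever $i<j$ and $k\ne i,j$, such that $S_{i,j}^+=\{1,\dots,m_j-\varepsilon_{i,j}\}$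 if $i<j$ and $S_{i,j}^+=\{0,\dots,m_j-\varepsilon_{i,j}\}$ if $i>j$ (an interval $\{a,\dots,b\}$ with $b<a$ being empty). Moreover, an arbitrary $\mathbf S$-braid arrangement is an $(\mathbf m,\varepsilon)$-arrangement if and only if it is transitive and $\lambda$ is a bijection from its regions to $\mathrm{Park}_{\mathbf S}$. The notions in (a) and (b) are as follows. *Parking functions.* $\mathrm{Park}_{\mathbf S}$ is the set of $p\in\mathbb Z_{\ge0}^n$ such that every non-empty $U\subseteq[n]$ contains some $u$ for which $p_u$ is less than the number of arcs from $u$ to vertices outside $U$ in the directed multigraph $D_{\mathbf S}$ on $[n+1]$, which has exactly $|S_{i,j}^+|$ arcs $(i,j)$ and one arc $(i,n+1)$ for all $i,j\in[n]$. *Labeling.* Let $R_0$ be the region containing $\{x\mid x_1>x_2>\dots>x_n>x_1-1\}$. For a region $R$, $\lambda(R)=(p_1,\dots,p_n)$ where $p_i$ is the number of pairs $(j,s)$ with $j\in[n]$, $s\in S_{i,j}^+$ such that $H_{i,j,s}$ separates $R$ from $R_0$. *Sketches.* An $(m,n)$-sketch is a word of length $(m+1)n$ whose set of letters is $\{\alpha_i^s\mid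 i\in[n],0\le s\le m\}$, such that for all $i,j\in[n]$ and $1\le s,t\le m$, $\alpha_i^{s-1}$ appears before $\alpha_i^s$, and if $\alpha_i^{s-1}$ appears before $\alpha_j^{t-1}$ then $\alpha_i^s$ appears before $\alpha_j^t$. $\mathcal M_{\mathbf S}$ is the set of $(m,n)$-sketches such that whenever $\alpha_j^s$ is immediately followed by $\alpha_i^0$, one has $(i,j,s)\in\mathrm{Triple}_{\mathbf S}$. $\mathcal L_{\mathbf S}$ is the set of $(m,n)$-sketches such that for every $j\in[n]$, if $s$ is maximum such that $\alpha_j^s$ is immediately followed by $\alpha_i^0$ for some $i$, then $(i,j,s)\in\mathrm{Triple}_{\mathbf S}$. *The set $\mathcal N_{\mathbf S}$* consists of the words $\Psi(p)$ for $p\in\mathrm{Park}_{\mathbf S}$, where $\Psi(p)$ is written letter by letter, keeping a tuple $P\in\mathbb Z^n$, initially $p$, and a list $O$ of indices, initially empty. If $P$ has a zero entry, let $k$ be the position of the rightmost one and write $\alpha_k^0$ (so $s=0$). Otherwise, if $O$ is non-empty, remove its first element $k$ and write $\alpha_k^s$, where $-s$ is the $k$-th entry of $P$. In both cases, subtract $1$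 from coordinate $k$ of $P$ and from every coordinate $i$ with a positive entry such that $s\in S_{i,k}^+$, and append $k$ at the end of $O$ if $s<m$. The process stops when $P$ has no zero entry and $O$ is empty. -/

import Mathlib

/-! Indices `1, …, n` are the elements of `Fin n`, with the same order.  A tuple
`S = (S_{i,j})_{i<j}` of finite sets of integers is a function `S : Fin n → Fin n → Finset ℤ`;
only its values `S i j` with `i < j` are ever used. -/

namespace SBraid

/-- The hyperplane `H_{i,j,s} = {x | x_i - x_j = s}` in `ℝⁿ`. -/
def hyperplane {n : ℕ} (i j : Fin n) (s : ℤ) : Set (Fin n → ℝ) :=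
  {x | x i - x j = (s : ℝ)}

/-- The `S`-braid arrangement, a set of hyperplanes. -/
def arrangement {n : ℕ} (S : Fin n → Fin n → Finset ℤ) : Set (Set (Fin n → ℝ)) :=
  {H | ∃ i j : Fin n, ∃ s : ℤ, i < j ∧ s ∈ S i j ∧ H = hyperplane i j s}

/-- The complement of the union of the hyperplanes. -/
def arrCompl {n : ℕ} (S : Fin n → Fin n → Finset ℤ) : Set (Fin n → ℝ) :=
  (⋃₀ arrangement S)ᶜ

/-- The regions of the arrangement: the connected components of the complement. -/
def regions {n : ℕ} (S : Fin n → Fin n → Finset ℤ) : Set (Set (Fin n → ℝ)) :=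
  {R | ∃ x ∈ arrCompl S, R = connectedComponentIn (arrCompl S) x}

/-- `S_{i,j}^+`: for `i < j` it is `{s > 0 | H_{i,j,s} ∈ A_S}`, and for `i > j` it is
`{s ≥ 0 | H_{i,j,s} ∈ A_S}`, where `H_{i,j,s} = H_{j,i,-s}`.  We set `S_{i,i}^+ = ∅`. -/
def plusSet {n : ℕ} (S : Fin n → Fin n → Finset ℤ) (i j : Fin n) : Finset ℕ :=
  if i < j then ((S i j).filter (fun s => 0 < s)).image Int.toNat
  else if j < i then ((S j i).filter (fun s => s ≤ 0)).image (fun s => (-s).toNat)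
  else ∅

theorem mem_plusSet_of_lt {n : ℕ} (S : Fin n → Fin n → Finset ℤ) {i j : Fin n} (h : i < j)
    (s : ℕ) : s ∈ plusSet S i j ↔ 0 < s ∧ (s : ℤ) ∈ S i j := by
  rw [plusSet, if_pos h]
  simp only [Finset.mem_image, Finset.mem_filter]
  constructor
  · rintro ⟨a, ⟨ha, h0⟩, rfl⟩
    rw [Int.toNat_of_nonneg h0.le]
    exact ⟨by omega, ha⟩
  · rintro ⟨h0, hs⟩
    exact ⟨s, ⟨hs, by omega⟩, by simp⟩

theorem mem_plusSet_of_gt {n : ℕ} (S : Fin n → Fin n → Finset ℤ) {i j : Fin n} (h : j < i)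
    (s : ℕ) : s ∈ plusSet S i j ↔ -(s : ℤ) ∈ S j i := by
  rw [plusSet, if_neg h.asymm, if_pos h]
  simp only [Finset.mem_image, Finset.mem_filter]
  constructor
  · rintro ⟨a, ⟨ha, h0⟩, rfl⟩
    rw [Int.toNat_of_nonneg (by omega), neg_neg]
    exact ha
  · intro hs
    exact ⟨-(s : ℤ), ⟨hs, by omega⟩, by simp⟩

/-! ### Parking functions -/

/-- The directed multigraph `D_S`, given by its arc multiplicities.  The vertex `some i` is `i`,
and `none` is the additional vertex `n+1`. -/
def multigraph {n : ℕ} (S : Fin n → Fin n → Finset ℤ) : Option (Fin n) → Option (Fin n) → ℕ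
  | some i, some j => (plusSet S i j).card
  | some _, none => 1
  | none, _ => 0

/-- `D`-parking functions, for a directed multigraph `D` given by its arc multiplicities: every
non-empty set `U` of vertices other than `n+1` contains some `u` such that `p u` is less than the
number of arcs from `u` to vertices outside of `U`. -/
def IsParking {n : ℕ} (D : Option (Fin n) → Option (Fin n) → ℕ) (p : Fin n → ℕ) : Prop :=
  ∀ U : Finset (Fin n), U.Nonempty →
    ∃ u ∈ U, p u < ∑ v : Option (Fin n) with v ∉ U.image some, D (some u) v

/-- The set of `D_S`-parking functions. -/
def Park {n : ℕ} (S : Fin n → Fin n → Finset ℤ) : Set (Fin n → ℕ) :=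
  {p | IsParking (multigraph S) p}

/-! ### The generalized Pak-Stanley labeling -/

/-- The fundamental alcove `x_1 > x_2 > ⋯ > x_n > x_1 - 1`. -/
def alcove (n : ℕ) : Set (Fin n → ℝ) :=
  {x | ∀ i j : Fin n, i < j → x j < x i ∧ x i < x j + 1}

/-- The region `R_0` containing the fundamental alcove. -/
def baseRegion {n : ℕ} (S : Fin n → Fin n → Finset ℤ) : Set (Fin n → ℝ) :=
  ⋃₀ {R | R ∈ regions S ∧ alcove n ⊆ R}

theorem alcove_subset_arrCompl {n : ℕ} (S : Fin n → Fin n → Finset ℤ) : alcove n ⊆ arrCompl S := by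
  rintro x hx ⟨H, ⟨i, j, s, hij, -, rfl⟩, h⟩
  obtain ⟨h1, h2⟩ := hx i j hij
  have h : x i - x j = (s:ℝ) := h
  have a : (0:ℝ) < s := by linarith
  have b : (s:ℝ) < 1 := by linarith
  norm_cast at a b; omega
theorem convex_alcove (n : ℕ) : Convex ℝ (alcove n) := by
  intro x hx y hy a b ha hb hab i j hij
  obtain ⟨h1, h2⟩ := hx i j hij
  obtain ⟨h3, h4⟩ := hy i j hij
  simp only [Pi.add_apply, Pi.smul_apply, smul_eq_mul]
  have hb' : b = 1 - a := by linarith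
  subst hb'
  constructor
  · rcases ha.eq_or_lt with rfl | ha'
    · simpa using h3
    · nlinarith
  · rcases ha.eq_or_lt with rfl | ha'
    · simpa using h4
    · nlinarith
theorem alcove_nonempty (n : ℕ) : (alcove n).Nonempty := by
  refine ⟨fun i => -(i:ℝ)/(n:ℝ), fun i j hij => ?_⟩
  have hn : (0:ℝ) < n := by exact_mod_cast (Nat.zero_le _).trans_lt i.2
  have h1 : ((i:ℕ):ℝ) < (j:ℕ) := by exact_mod_cast hij
  have h2 : ((j:ℕ):ℝ) < n := by exact_mod_cast j.2
  have h3 : (0:ℝ) ≤ (i:ℕ) := by positivity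
  constructor
  · exact div_lt_div_of_pos_right (by linarith) hn
  · rw [div_add_one hn.ne']; exact div_lt_div_of_pos_right (by linarith) hn
/-- `R_0` is a region and contains the fundamental alcove. -/
theorem baseRegion_mem {n : ℕ} (S : Fin n → Fin n → Finset ℤ) :
    baseRegion S ∈ regions S ∧ alcove n ⊆ baseRegion S := by
  obtain ⟨x, hx⟩ := alcove_nonempty n
  have hsub : alcove n ⊆ connectedComponentIn (arrCompl S) x :=
    (convex_alcove n).isPreconnected.subset_connectedComponentIn hx (alcove_subset_arrCompl S)
  have : baseRegion S = connectedComponentIn (arrCompl S) x := by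
    apply Set.Subset.antisymm
    · rintro y ⟨R, ⟨⟨z, hz, rfl⟩, hR⟩, hy⟩
      rwa [connectedComponentIn_eq (hR hx)] at hy
    · exact Set.subset_sUnion_of_mem (t := connectedComponentIn (arrCompl S) x)
        ⟨⟨x, alcove_subset_arrCompl S hx, rfl⟩, hsub⟩
  rw [this]
  exact ⟨⟨x, alcove_subset_arrCompl S hx, rfl⟩, hsub⟩

/-- The hyperplane `H_{i,j,s}` separates `R` from `R'`: the two sets lie strictly on opposite
sides of it. -/
def Separates {n : ℕ} (i j : Fin n) (s : ℤ) (R R' : Set (Fin n → ℝ)) : Prop :=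
  ((∀ x ∈ R, x i - x j < s) ∧ (∀ y ∈ R', (s : ℝ) < y i - y j)) ∨
  ((∀ x ∈ R, (s : ℝ) < x i - x j) ∧ (∀ y ∈ R', y i - y j < s))

/-- The generalized Pak-Stanley label of a region: its `i`-th entry is the number of pairs `(j, s)`
with `s ∈ S_{i,j}^+` such that `H_{i,j,s}` separates the region from `R_0`. -/
noncomputable def gpsLabel {n : ℕ} (S : Fin n → Fin n → Finset ℤ) (R : Set (Fin n → ℝ)) :
    Fin n → ℕ :=
  fun i => Set.ncard {q : Fin n × ℕ | q.2 ∈ plusSet S i q.1 ∧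
    Separates i q.1 (q.2 : ℤ) R (baseRegion S)}

/-! ### Triples and transitivity -/

/-- `(i,j,s) ∈ Triple_S`. -/
def IsTriple {n : ℕ} (S : Fin n → Fin n → Finset ℤ) (i j : Fin n) (s : ℕ) : Prop :=
  s ∈ plusSet S i j ∨ (s = 0 ∧ i < j)

/-- Transitivity. -/
def IsTransitive {n : ℕ} (S : Fin n → Fin n → Finset ℤ) : Prop :=
  ∀ (i j k : Fin n) (s t : ℕ),
    ¬ IsTriple S i j s → ¬ IsTriple S j k t → ¬ IsTriple S i k (s + t)

/-- The weaker form of transitivity that concerns distinct indices only. -/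
def IsTransitiveDistinct {n : ℕ} (S : Fin n → Fin n → Finset ℤ) : Prop :=
  ∀ (i j k : Fin n) (s t : ℕ), i ≠ j → j ≠ k → i ≠ k →
    ¬ IsTriple S i j s → ¬ IsTriple S j k t → ¬ IsTriple S i k (s + t)

/-! ### Sketches -/

/-- The number `m = max ⋃ S_{i,j}^+` (equal to `0` if the union is empty). -/
def maxShift {n : ℕ} (S : Fin n → Fin n → Finset ℤ) : ℕ :=
  Finset.univ.sup fun i => Finset.univ.sup fun j => (plusSet S i j).sup id

/-- `a` occurs before `b` in the word `w`. -/
def Before {α : Type} (w : List α) (a b : α) : Prop :=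
  ∃ p q : ℕ, p < q ∧ w[p]? = some a ∧ w[q]? = some b

/-- `a` is immediately followed by `b` in the word `w`. -/
def FollowedBy {α : Type} (w : List α) (a b : α) : Prop :=
  ∃ p : ℕ, w[p]? = some a ∧ w[p + 1]? = some b

/-- `(m,n)`-sketches; the letter `α_i^s` is the pair `(i, s)`. -/
structure IsSketch {n : ℕ} (m : ℕ) (w : List (Fin n × ℕ)) : Prop where
  length_eq : w.length = (m + 1) * n
  mem_iff : ∀ (i : Fin n) (s : ℕ), (i, s) ∈ w ↔ s ≤ m
  before_succ : ∀ (i : Fin n) (s : ℕ), 1 ≤ s → s ≤ m → Before w (i, s - 1) (i, s)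
  before_shift : ∀ (i j : Fin n) (s t : ℕ), 1 ≤ s → s ≤ m → 1 ≤ t → t ≤ m →
    Before w (i, s - 1) (j, t - 1) → Before w (i, s) (j, t)

/-- `L_S`, the `S`-locally maximal sketches: if `s` is maximum such that `α_j^s` is immediately
followed by a letter `α_i^0`, then `(i,j,s) ∈ Triple_S`. -/
def setL {n : ℕ} (S : Fin n → Fin n → Finset ℤ) : Set (List (Fin n × ℕ)) :=
  {w | IsSketch (maxShift S) w ∧ ∀ (i j : Fin n) (s : ℕ), FollowedBy w (j, s) (i, 0) →
    (∀ (i' : Fin n) (s' : ℕ), FollowedBy w (j, s') (i', 0) → s' ≤ s) → IsTriple S i j s}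

/-- `M_S`: whenever `α_j^s` is immediately followed by `α_i^0`, one has `(i,j,s) ∈ Triple_S`. -/
def setM {n : ℕ} (S : Fin n → Fin n → Finset ℤ) : Set (List (Fin n × ℕ)) :=
  {w | IsSketch (maxShift S) w ∧
    ∀ (i j : Fin n) (s : ℕ), FollowedBy w (j, s) (i, 0) → IsTriple S i j s}

/-- The update of the tuple `P` when the letter `α_k^s` is written: subtract `1` from coordinate
`k` and from every coordinate `i` with a positive entry such that `s ∈ S_{i,k}^+`. -/
def psiUpdate {n : ℕ} (S : Fin n → Fin n → Finset ℤ) (P : Fin n → ℤ) (k : Fin n) (s : ℕ) :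
    Fin n → ℤ :=
  fun i => if i = k ∨ (0 < P i ∧ s ∈ plusSet S i k) then P i - 1 else P i

/-- The list obtained from `O` when the letter `α_k^s` is written: `k` is appended at the end if
the letter `α_k^{s+1}` is still to come, that is, if `s < m`. -/
def psiAppend {n : ℕ} (S : Fin n → Fin n → Finset ℤ) (O : List (Fin n)) (k : Fin n) (s : ℕ) :
    List (Fin n) :=
  if s < maxShift S then O ++ [k] else O

/-- `PsiRun S P O w`: the (deterministic) process defining `Ψ`, started with the tuple `P` and the
list `O`, terminates and writes the word `w`. -/
inductive PsiRun {n : ℕ} (S : Fin n → Fin n → Finset ℤ) :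
    (Fin n → ℤ) → List (Fin n) → List (Fin n × ℕ) → Prop
  /-- No zero entry and an empty list: the process terminates. -/
  | halt (P : Fin n → ℤ) (hP : ∀ i, P i ≠ 0) : PsiRun S P [] []
  /-- Case 1: `k` is the rightmost zero entry; write `α_k^0`. -/
  | zero (P : Fin n → ℤ) (O : List (Fin n)) (k : Fin n) (w : List (Fin n × ℕ))
      (hk : P k = 0) (hlast : ∀ i, k < i → P i ≠ 0)
      (hrun : PsiRun S (psiUpdate S P k 0) (psiAppend S O k 0) w) :
      PsiRun S P O ((k, 0) :: w)
  /-- Case 2: no zero entry, `k` is the first element of the list; write `α_k^s`, where `-s` is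
  the `k`-th entry. -/
  | queue (P : Fin n → ℤ) (k : Fin n) (O : List (Fin n)) (s : ℕ) (w : List (Fin n × ℕ))
      (hP : ∀ i, P i ≠ 0) (hs : P k = -(s : ℤ))
      (hrun : PsiRun S (psiUpdate S P k s) (psiAppend S O k s) w) :
      PsiRun S P (k :: O) ((k, s) :: w)

/-- `N_S`, the image by `Ψ` of the set of `D_S`-parking functions. -/
def setN {n : ℕ} (S : Fin n → Fin n → Finset ℤ) : Set (List (Fin n × ℕ)) :=
  {w | ∃ p ∈ Park S, PsiRun S (fun i => (p i : ℤ)) [] w}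

/-! ### Properties (X) and (Y), and the arrangements defined by `m` and `ε` -/

/-- Property (X). The index `k` is different from `i` and from `j`, so that `S_{i,k}^+` and
`S_{j,k}^+` are defined. -/
def PropertyX {n : ℕ} (S : Fin n → Fin n → Finset ℤ) : Prop :=
  ∀ i j k : Fin n, i < j → k ≠ i → k ≠ j →
    ∀ s ∈ plusSet S j k, s ∈ plusSet S i k ∨ (s = 0 ∧ i < k)

/-- Property (Y). The index `j` is different from `i` and from `k`, so that `S_{i,j}^+` and
`S_{k,j}^+` are defined. -/
def PropertyY {n : ℕ} (S : Fin n → Fin n → Finset ℤ) : Prop :=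
  ∀ i j k : Fin n, i ≠ j → k ≠ j → k ≠ i → ∀ s : ℕ, (0 < s ∨ j < i) →
    s ∉ plusSet S i j → ∀ t : ℕ, 0 < t → s + t ∉ plusSet S k j

/-- The arrangement of the tuple `S` is an `(m,ε)`-arrangement for some `m` and `ε`.
Intervals `[a;b]` with `b < a` are empty. -/
def IsMEpsArrangement {n : ℕ} (S : Fin n → Fin n → Finset ℤ) : Prop :=
  ∃ (m : Fin n → ℕ) (ε : Fin n → Fin n → ℕ),
    (∀ i j : Fin n, i ≠ j → ε i j = 0 ∨ ε i j = 1) ∧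
    (∀ i j k : Fin n, i < j → k ≠ i → k ≠ j → ε i k ≤ ε j k) ∧
    (∀ i j : Fin n, i < j → ∀ s : ℕ,
      s ∈ plusSet S i j ↔ (s : ℤ) ∈ Set.Icc (1 : ℤ) ((m j : ℤ) - (ε i j : ℤ))) ∧
    (∀ i j : Fin n, j < i → ∀ s : ℕ,
      s ∈ plusSet S i j ↔ (s : ℤ) ∈ Set.Icc (0 : ℤ) ((m j : ℤ) - (ε i j : ℤ)))

end SBraid

namespace SBraid

variable {n : ℕ} {S : Fin n → Fin n → Finset ℤ}

/-! ### Arithmetic of the sets `S_{i,j}^+` -/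

theorem plusSet_self (i : Fin n) : plusSet S i i = ∅ := by simp [plusSet]

theorem ne_of_mem_plusSet {i j : Fin n} {s : ℕ} (h : s ∈ plusSet S i j) : i ≠ j := by
  rintro rfl
  simp [plusSet_self] at h

theorem pos_or_lt_of_mem_plusSet {i j : Fin n} {s : ℕ} (h : s ∈ plusSet S i j) :
    0 < s ∨ j < i := by
  rcases lt_trichotomy i j with hij | rfl | hij
  · exact Or.inl ((mem_plusSet_of_lt S hij s).1 h).1
  · simp [plusSet_self] at h
  · exact Or.inr hij

theorem le_maxShift {i j : Fin n} {s : ℕ} (h : s ∈ plusSet S i j) : s ≤ maxShift S :=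
  calc s ≤ (plusSet S i j).sup id := Finset.le_sup (f := id) h
    _ ≤ Finset.univ.sup fun j => (plusSet S i j).sup id :=
      Finset.le_sup (f := fun j => (plusSet S i j).sup id) (Finset.mem_univ j)
    _ ≤ maxShift S :=
      Finset.le_sup (f := fun i => Finset.univ.sup fun j => (plusSet S i j).sup id)
        (Finset.mem_univ i)

theorem not_isTriple_self (i : Fin n) (s : ℕ) : ¬ IsTriple S i i s := by
  simp [IsTriple, plusSet_self]

/-- Two hyperplanes `H_{i,j,s}` and `H_{i,k,t}` with `s ∈ S_{i,j}^+` and `t ∈ S_{i,k}^+` lie in the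
arrangement only together with `H_{j,k,t-s}`. -/
def Coherent (S : Fin n → Fin n → Finset ℤ) : Prop :=
  ∀ (i j k : Fin n) (s d : ℕ), j ≠ k → s ∈ plusSet S i j → s + d ∈ plusSet S i k →
    (0 < d ∨ k < j) → d ∈ plusSet S j k

/-- The sets `S_{i,j}^+` are intervals. -/
def HasIntervals (S : Fin n → Fin n → Finset ℤ) : Prop :=
  ∀ (i j : Fin n) (s : ℕ), i ≠ j → (0 < s ∨ j < i) → s ∉ plusSet S i j →
    s + 1 ∉ plusSet S i j

/-! ### Consequences of the `(m,ε)` form -/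

theorem isMEpsArrangement_iff : IsMEpsArrangement S ↔
    ∃ (m : Fin n → ℕ) (ε : Fin n → Fin n → ℕ), (∀ i j : Fin n, i ≠ j → ε i j ≤ 1) ∧
      (∀ i j k : Fin n, i < j → k ≠ i → k ≠ j → ε i k ≤ ε j k) ∧
      ∀ i j : Fin n, i ≠ j → ∀ s : ℕ,
        s ∈ plusSet S i j ↔ (0 < s ∨ j < i) ∧ s + ε i j ≤ m j := by
  refine exists_congr fun m => exists_congr fun ε => ?_
  constructor
  · rintro ⟨h1, h2, h3, h4⟩
    refine ⟨fun i j hij => by have := h1 i j hij; omega, h2, fun i j hij s => ?_⟩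
    rcases lt_or_gt_of_ne hij with h | h
    · rw [h3 i j h, Set.mem_Icc]
      have := h.asymm
      constructor
      · intro h'; exact ⟨Or.inl (by omega), by omega⟩
      · rintro ⟨h' | h', _⟩
        · omega
        · exact absurd h' this
    · rw [h4 i j h, Set.mem_Icc]
      constructor
      · intro h'; exact ⟨Or.inr h, by omega⟩
      · rintro ⟨_, _⟩; omega
  · rintro ⟨h1, h2, h3⟩
    refine ⟨fun i j hij => by have := h1 i j hij; omega, h2, fun i j h s => ?_, fun i j h s => ?_⟩
    · rw [h3 i j h.ne, Set.mem_Icc]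
      have := h.asymm
      constructor
      · rintro ⟨h' | h', _⟩
        · omega
        · exact absurd h' this
      · intro h'; exact ⟨Or.inl (by omega), by omega⟩
    · rw [h3 i j h.ne', Set.mem_Icc]
      constructor
      · rintro ⟨_, _⟩; omega
      · intro h'; exact ⟨Or.inr h, by omega⟩

theorem IsMEpsArrangement.propertyX (h : IsMEpsArrangement S) : PropertyX S := by
  obtain ⟨m, ε, -, h2, h3⟩ := isMEpsArrangement_iff.1 h
  intro i j k hij hki hkj s hs
  have := h2 i j k hij hki hkj
  rw [h3 j k hkj.symm] at hs
  rw [h3 i k hki.symm]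
  rcases Nat.eq_zero_or_pos s with rfl | h0
  · rcases lt_or_gt_of_ne hki with h' | h'
    · exact Or.inl ⟨Or.inr h', by omega⟩
    · exact Or.inr ⟨rfl, h'⟩
  · exact Or.inl ⟨Or.inl h0, by omega⟩

theorem IsMEpsArrangement.propertyY (h : IsMEpsArrangement S) : PropertyY S := by
  obtain ⟨m, ε, h1, h2, h3⟩ := isMEpsArrangement_iff.1 h
  intro i j k hij hkj hki s hs hn t ht
  have := h1 i j hij
  rw [h3 i j hij] at hn
  rw [h3 k j hkj]
  rintro ⟨-, h'⟩
  exact hn ⟨hs, by omega⟩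

/-- From `s + d + ε i k ≤ m k` one needs `d + ε j k ≤ m k`. If `s > 0`, then `s` absorbs `ε j k ≤
1`. If `s = 0`, then `j < i` and monotonicity gives `ε j k ≤ ε i k`. -/
theorem IsMEpsArrangement.coherent (h : IsMEpsArrangement S) : Coherent S := by
  obtain ⟨m, ε, h1, h2, h3⟩ := isMEpsArrangement_iff.1 h
  intro i j k s d hjk hs ht hd
  have hij := ne_of_mem_plusSet hs
  have hik := ne_of_mem_plusSet ht
  rw [h3 i j hij] at hs
  rw [h3 i k hik] at ht
  rw [h3 j k hjk]
  refine ⟨hd, ?_⟩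
  have := h1 j k hjk
  rcases Nat.eq_zero_or_pos s with rfl | h0
  · have hji : j < i := hs.1.resolve_left (lt_irrefl 0)
    have := h2 j i k hji hjk.symm hik.symm
    omega
  · omega

/-- For distinct indices, a triple `(i,k,s+t)` forces `(j,k,t)` to be one, by the same dichotomy as
for coherence: either `s ≥ 1` absorbs `ε j k`, or `s = 0` and the first hypothesis means `j < i`. -/
theorem IsMEpsArrangement.isTransitive (h : IsMEpsArrangement S) : IsTransitive S := by
  obtain ⟨m, ε, h1, h2, h3⟩ := isMEpsArrangement_iff.1 h
  have key : ∀ i j : Fin n, i ≠ j → ∀ s, IsTriple S i j s ↔ (i < j ∧ s = 0) ∨ s + ε i j ≤ m j := by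
    intro i j hij s
    rw [IsTriple, h3 i j hij]
    rcases lt_or_gt_of_ne hij with h | h
    · simp only [h, h.asymm, and_true, true_and, or_false]; omega
    · simp only [h, h.asymm, and_false, false_and, or_true, or_false, true_and, false_or]
  intro i j k s t hs ht
  by_cases hik : i = k
  · subst hik; exact not_isTriple_self i _
  rw [key i k hik]
  by_cases hij : i = j
  · subst hij
    rw [key i k hik] at ht
    rintro (⟨h, h'⟩ | h)
    · exact ht (Or.inl ⟨h, by omega⟩)
    · exact ht (Or.inr (by omega))
  by_cases hjk : j = k
  · subst hjk
    rw [key i j hij] at hs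
    rintro (⟨h, h'⟩ | h)
    · exact hs (Or.inl ⟨h, by omega⟩)
    · exact hs (Or.inr (by omega))
  rw [key i j hij] at hs
  rw [key j k hjk] at ht
  have e1 := h1 j k hjk
  have e2 := h1 i k hik
  rcases Nat.eq_zero_or_pos s with rfl | h0
  · have hji : j < i := by
      rcases lt_or_gt_of_ne hij with h | h
      · exact absurd (Or.inl ⟨h, rfl⟩) hs
      · exact h
    have := h2 j i k hji (Ne.symm hjk) (Ne.symm hik)
    rintro (⟨ha, hb⟩ | ha)
    · exact ht (Or.inl ⟨hji.trans ha, by omega⟩)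
    · exact ht (Or.inr (by omega))
  · rintro (⟨ha, hb⟩ | ha)
    · omega
    · exact ht (Or.inr (by omega))

/-- Suppose `s + t ∈ S_{k,j}^+`. If `t ∈ S_{k,i}^+`, coherence at `k` puts `s` in `S_{i,j}^+`.
Otherwise neither `(k,i,t)` nor `(i,j,s)` is a triple, and transitivity through `i` gives a
contradiction. -/
theorem PropertyY.of_coherent (hZ : Coherent S) (hT : IsTransitiveDistinct S) : PropertyY S := by
  intro i j k hij hkj hki s hs hn t ht hmem
  by_cases hki' : t ∈ plusSet S k i
  · exact hn (hZ k i j t s hij hki' (by rwa [add_comm]) hs)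
  · refine hT k i j t s hki hij hkj ?_ ?_ (Or.inl (by rwa [add_comm]))
    · rintro (h | h)
      · exact hki' h
      · omega
    · rintro (h | ⟨h, h'⟩)
      · exact hn h
      · rcases hs with hs | hs
        · omega
        · exact absurd h' hs.asymm

/-- The dichotomy is whether `0 ∈ S_{j,i}^+`: if so, coherence at `j` moves `s` to `S_{i,k}^+`; if
not, `(j,i,0)` is no triple and transitivity through `i` applies. -/
theorem PropertyX.of_coherent (hZ : Coherent S) (hT : IsTransitiveDistinct S) : PropertyX S := by
  intro i j k hij hki hkj s hs
  by_contra hn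
  push Not at hn
  by_cases hji : 0 ∈ plusSet S j i
  · refine hn.1 (hZ j i k 0 s hki.symm hji (by rwa [zero_add]) ?_)
    rcases Nat.eq_zero_or_pos s with rfl | h0
    · exact Or.inr (lt_of_le_of_ne (hn.2 rfl) hki)
    · exact Or.inl h0
  · refine hT j i k 0 s hij.ne' hki.symm hkj.symm ?_ ?_ (Or.inl (by rwa [zero_add]))
    · rintro (h | ⟨-, h⟩)
      · exact hji h
      · exact absurd h hij.asymm
    · rintro (h | ⟨h, h'⟩)
      · exact hn.1 h
      · exact absurd h' (hn.2 h).not_gt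

/-! ### Transitivity, intervals and the recovery of `m` and `ε` -/

theorem IsTransitive.distinct (h : IsTransitive S) : IsTransitiveDistinct S :=
  fun i j k s t _ _ _ => h i j k s t

/-- This uses transitivity with a repeated index: `(i,i,1)` is never a triple, so a non-triple
`(i,j,s)` yields the non-triple `(i,j,s+1)`. -/
theorem IsTransitive.hasIntervals (h : IsTransitive S) : HasIntervals S := by
  intro i j s hij hs hn hmem
  refine h i i j 1 s (not_isTriple_self i 1) ?_ (Or.inl (by rwa [add_comm]))
  rintro (h | ⟨h, h'⟩)
  · exact hn h
  · rcases hs with hs | hs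
    · omega
    · exact absurd h' hs.asymm

/-- A third index `k` serves as a detour. If `k < i`, (X) carries `s + 1` from `S_{i,j}^+` to
`S_{k,j}^+`, against (Y). If `i < k`, (Y) forces `s ∈ S_{k,j}^+`, and (X) carries it back to
`S_{i,j}^+`. -/
theorem HasIntervals.of_propertyX_propertyY (hn : n ≠ 2) (hX : PropertyX S) (hY : PropertyY S) :
    HasIntervals S := by
  intro i j s hij hs hs0 hmem
  obtain ⟨k, hki, hkj⟩ : ∃ k : Fin n, k ≠ i ∧ k ≠ j := by
    by_contra hc
    push Not at hc
    have h2 : (Finset.univ : Finset (Fin n)) = {i, j} := by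
      ext k
      simp only [Finset.mem_univ, Finset.mem_insert, Finset.mem_singleton, true_iff]
      by_cases h : k = i
      · exact Or.inl h
      · exact Or.inr (hc k h)
    have h3 := congrArg Finset.card h2
    rw [Finset.card_univ, Fintype.card_fin, Finset.card_pair hij] at h3
    exact hn h3
  rcases lt_or_gt_of_ne hki with h | h
  · rcases hX k i j h hkj.symm hij.symm _ hmem with h' | h'
    · exact hY i j k hij hkj hki s hs hs0 1 one_pos h'
    · omega
  · refine hY k j i hkj hij hki.symm s (hs.imp id fun h' => h'.trans h) ?_ 1 one_pos hmem
    intro h'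
    rcases hX i k j h hij.symm hkj.symm _ h' with h'' | ⟨h'', h'''⟩
    · exact hs0 h''
    · rcases hs with hs | hs
      · omega
      · exact absurd h''' hs.asymm

/-- With intervals, membership in `S_{i,j}^+` is decided by a threshold. -/
theorem HasIntervals.exists_threshold (hI : HasIntervals S) :
    ∃ N : Fin n → Fin n → ℕ, (∀ i j, i < j → 1 ≤ N i j) ∧
      ∀ i j, i ≠ j → ∀ s, s ∈ plusSet S i j ↔ (0 < s ∨ j < i) ∧ s < N i j := by
  have key : ∀ i j : Fin n, ∃ N : ℕ, (i < j → 1 ≤ N) ∧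
      (i ≠ j → ∀ s, s ∈ plusSet S i j ↔ (0 < s ∨ j < i) ∧ s < N) := by
    intro i j
    by_cases hij : i = j
    · exact ⟨1, fun _ => le_rfl, fun h => absurd hij h⟩
    -- The threshold is the least admissible value missing from the set; everything above `maxShift
    -- S` is missing.
    have hex : ∃ N : ℕ, (0 < N ∨ j < i) ∧ N ∉ plusSet S i j :=
      ⟨maxShift S + 1, Or.inl (by omega), fun h => by have := le_maxShift h; omega⟩
    classical
    have hspec := Nat.find_spec hex
    refine ⟨Nat.find hex, fun h => ?_, fun _ s => ⟨fun hs => ?_, fun hs => ?_⟩⟩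
    · rcases hspec.1 with h' | h'
      · exact h'
      · exact absurd h' h.asymm
    · refine ⟨pos_or_lt_of_mem_plusSet hs, ?_⟩
      by_contra hle
      push Not at hle
      have : ∀ d, Nat.find hex + d ∉ plusSet S i j := by
        intro d
        induction d with
        | zero => exact hspec.2
        | succ d ih =>
          exact hI i j _ hij (hspec.1.imp (fun h => Nat.add_pos_left h d) id) ih
      obtain ⟨d, rfl⟩ := Nat.exists_eq_add_of_le hle
      exact this d hs
    · by_contra hn
      exact Nat.find_min hex hs.2 ⟨hs.1, hn⟩
  choose N hN1 hN2 using key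
  exact ⟨N, hN1, fun i j => hN2 i j⟩

/-- In terms of thresholds, (X) makes `N i k` weakly decreasing in `i`, and (Y) makes the `N i j`
for a fixed `j` differ by at most one. So `m j` is the largest threshold minus one, and `ε i j` is
the defect of `N i j` from the largest. -/
theorem IsMEpsArrangement.of_propertyX_propertyY (hI : HasIntervals S) (hX : PropertyX S)
    (hY : PropertyY S) : IsMEpsArrangement S := by
  obtain ⟨N, hN1, hN⟩ := hI.exists_threshold
  have hmono : ∀ i j k : Fin n, i < j → k ≠ i → k ≠ j → N j k ≤ N i k := by
    intro i j k hij hki hkj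
    by_contra hlt
    push Not at hlt
    have hpos : 0 < N i k ∨ k < i := by
      rcases lt_or_gt_of_ne hki with h | h
      · exact Or.inr h
      · exact Or.inl (hN1 i k h)
    rcases hX i j k hij hki hkj (N i k)
      ((hN j k hkj.symm _).2 ⟨hpos.imp id fun h => h.trans hij, hlt⟩) with h | ⟨h, h'⟩
    · exact lt_irrefl _ ((hN i k hki.symm _).1 h).2
    · have := hN1 i k h'
      omega
  have hclose : ∀ i j k : Fin n, i ≠ j → k ≠ j → N k j ≤ N i j + 1 := by
    intro i j k hij hkj
    by_cases hki : k = i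
    · subst hki; omega
    by_contra hlt
    push Not at hlt
    have hpos : 0 < N i j ∨ j < i := by
      rcases lt_or_gt_of_ne hij with h | h
      · exact Or.inl (hN1 i j h)
      · exact Or.inr h
    refine hY i j k hij hkj hki (N i j) hpos ?_ 1 one_pos ((hN k j hkj _).2 ⟨Or.inl (by omega), hlt⟩)
    rw [hN i j hij]
    exact fun h => lt_irrefl _ h.2
  -- The lower bound `1` keeps `M j - 1` from truncating when all thresholds vanish (or there are
  -- none); then every `ε i j` is `1` and `m j = 0`, which still describes empty sets.
  set M : Fin n → ℕ := fun j => max 1 ((Finset.univ.filter (· ≠ j)).sup fun i => N i j) with hM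
  have hle : ∀ i j, i ≠ j → N i j ≤ M j := fun i j hij =>
    le_max_of_le_right (Finset.le_sup (f := fun i => N i j) (by simpa using hij))
  have hge : ∀ i j, i ≠ j → M j ≤ N i j + 1 := fun i j hij =>
    max_le (by omega) (Finset.sup_le fun k hk => hclose i j k hij (by simpa using hk))
  have h1 : ∀ j, 1 ≤ M j := fun j => le_max_left _ _
  refine isMEpsArrangement_iff.2 ⟨fun j => M j - 1, fun i j => M j - N i j, ?_, ?_, ?_⟩
  · intro i j hij
    have := hge i j hij
    show M j - N i j ≤ 1
    omega
  · intro i j k hij hki hkj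
    have := hmono i j k hij hki hkj
    show M k - N i k ≤ M k - N j k
    omega
  · intro i j hij s
    have := hle i j hij
    have := h1 j
    rw [hN i j hij]
    refine and_congr_right fun _ => ?_
    show s < N i j ↔ s + (M j - N i j) ≤ M j - 1
    omega

/-! ### Regions and their labels -/

theorem mem_arrCompl_iff {x : Fin n → ℝ} :
    x ∈ arrCompl S ↔ ∀ (i j : Fin n) (s : ℕ), s ∈ plusSet S i j → x j + s ≠ x i := by
  constructor
  · intro hx i j s hs he
    rcases lt_or_gt_of_ne (ne_of_mem_plusSet hs) with h | h
    · refine hx ⟨_, ⟨i, j, s, h, ((mem_plusSet_of_lt S h s).1 hs).2, rfl⟩, ?_⟩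
      show x i - x j = ((s : ℤ) : ℝ)
      push_cast; linarith
    · refine hx ⟨_, ⟨j, i, -s, h, (mem_plusSet_of_gt S h s).1 hs, rfl⟩, ?_⟩
      show x j - x i = ((-(s : ℤ) : ℤ) : ℝ)
      push_cast; linarith
  · rintro hx ⟨_, ⟨i, j, s, hij, hs, rfl⟩, h⟩
    have h : x i - x j = (s : ℝ) := h
    rcases lt_or_ge 0 s with h0 | h0
    · obtain ⟨r, rfl⟩ := Int.eq_ofNat_of_zero_le h0.le
      refine hx i j r ((mem_plusSet_of_lt S hij r).2 ⟨by omega, hs⟩) ?_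
      push_cast at h; linarith
    · obtain ⟨r, hr⟩ := Int.eq_ofNat_of_zero_le (neg_nonneg.2 h0)
      obtain rfl : s = -(r : ℤ) := by omega
      refine hx j i r ((mem_plusSet_of_gt S hij r).2 hs) ?_
      push_cast at h; linarith

/-- The two points lie on the same side of every hyperplane of the arrangement. -/
def SameSide (S : Fin n → Fin n → Finset ℤ) (x y : Fin n → ℝ) : Prop :=
  ∀ (i j : Fin n) (s : ℕ), s ∈ plusSet S i j → (x j + s < x i ↔ y j + s < y i)

theorem sameSide_of_mem {x y : Fin n → ℝ} (hx : x ∈ arrCompl S)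
    (h : y ∈ connectedComponentIn (arrCompl S) x) : SameSide S x y := by
  intro i j s hs
  have hpre : IsPreconnected (connectedComponentIn (arrCompl S) x) :=
    isPreconnected_connectedComponentIn
  have hcont : Continuous fun z : Fin n → ℝ => z i - z j := by fun_prop
  have hord := (hpre.image _ hcont.continuousOn).ordConnected
  have hno : (s : ℝ) ∉ (fun z : Fin n → ℝ => z i - z j) '' connectedComponentIn (arrCompl S) x := by
    rintro ⟨z, hz, hzs⟩
    have hzs : z i - z j = s := hzs
    exact mem_arrCompl_iff.1 (connectedComponentIn_subset _ _ hz) i j s hs (by linarith)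
  have hx' := Set.mem_image_of_mem (fun z : Fin n → ℝ => z i - z j) (mem_connectedComponentIn hx)
  have hy' := Set.mem_image_of_mem (fun z : Fin n → ℝ => z i - z j) h
  constructor
  · intro hlt
    by_contra hle
    exact hno (hord.out hy' hx' ⟨by linarith, by linarith⟩)
  · intro hlt
    by_contra hle
    exact hno (hord.out hx' hy' ⟨by linarith, by linarith⟩)

/-- Open half-spaces are convex, so the segment from `x` to `y` meets no hyperplane and is a
connected part of the complement. Regions are thus the classes of `SameSide`. -/
theorem mem_of_sameSide {x y : Fin n → ℝ} (hx : x ∈ arrCompl S) (hy : y ∈ arrCompl S)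
    (h : SameSide S x y) : y ∈ connectedComponentIn (arrCompl S) x := by
  refine (convex_segment (𝕜 := ℝ) x y).isPreconnected.subset_connectedComponentIn
    (left_mem_segment ℝ x y) (fun z hz => ?_) (right_mem_segment ℝ x y)
  rw [mem_arrCompl_iff] at hx hy ⊢
  intro i j s hs he
  set f : (Fin n → ℝ) →ₗ[ℝ] ℝ :=
    LinearMap.proj (R := ℝ) (φ := fun _ => ℝ) i - LinearMap.proj (R := ℝ) (φ := fun _ => ℝ) j
  have hfz : ∀ z, f z = z i - z j := fun z => rfl
  rcases lt_or_gt_of_ne (hx i j s hs) with h1 | h1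
  · have h2 := (h i j s hs).1 h1
    have := ((convex_Ioi (s : ℝ)).linear_preimage f).segment_subset (x := x) (y := y)
      (by rw [Set.mem_preimage, hfz, Set.mem_Ioi]; linarith)
      (by rw [Set.mem_preimage, hfz, Set.mem_Ioi]; linarith) hz
    rw [Set.mem_preimage, hfz, Set.mem_Ioi] at this
    linarith
  · have h2 : y i < y j + s :=
      lt_of_le_of_ne (not_lt.1 fun h' => h1.not_gt ((h i j s hs).2 h')) (hy i j s hs).symm
    have := ((convex_Iio (s : ℝ)).linear_preimage f).segment_subset (x := x) (y := y)
      (by rw [Set.mem_preimage, hfz, Set.mem_Iio]; linarith)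
      (by rw [Set.mem_preimage, hfz, Set.mem_Iio]; linarith) hz
    rw [Set.mem_preimage, hfz, Set.mem_Iio] at this
    linarith

/-- The pairs `(j,s)` with `s ∈ S_{i,j}^+` such that `x_i - x_j > s`. -/
noncomputable def crossed (S : Fin n → Fin n → Finset ℤ) (x : Fin n → ℝ) (i : Fin n) :
    Finset (Fin n × ℕ) :=
  (Finset.univ ×ˢ Finset.range (maxShift S + 1)).filter
    fun q => q.2 ∈ plusSet S i q.1 ∧ x q.1 + q.2 < x i

theorem mem_crossed {x : Fin n → ℝ} {i : Fin n} {q : Fin n × ℕ} :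
    q ∈ crossed S x i ↔ q.2 ∈ plusSet S i q.1 ∧ x q.1 + q.2 < x i := by
  rw [crossed, Finset.mem_filter, and_iff_right_iff_imp]
  intro h
  simpa [Nat.lt_succ_iff] using le_maxShift h.1

theorem lt_of_mem_alcove {a : Fin n → ℝ} (ha : a ∈ alcove n) {i j : Fin n} {s : ℕ}
    (hs : s ∈ plusSet S i j) : a i < a j + s := by
  rcases lt_or_gt_of_ne (ne_of_mem_plusSet hs) with h | h
  · have h1 : (1 : ℝ) ≤ s := by exact_mod_cast ((mem_plusSet_of_lt S h s).1 hs).1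
    have := (ha i j h).2
    linarith
  · have h1 : (0 : ℝ) ≤ s := Nat.cast_nonneg s
    have := (ha j i h).1
    linarith

theorem lt_of_mem_baseRegion {y : Fin n → ℝ} (hy : y ∈ baseRegion S) {i j : Fin n} {s : ℕ}
    (hs : s ∈ plusSet S i j) : y i < y j + s := by
  obtain ⟨a, ha⟩ := alcove_nonempty n
  obtain ⟨⟨z, hz, hR⟩, hsub⟩ := baseRegion_mem S
  have haR := hsub ha
  rw [hR] at hy haR
  have h1 := (sameSide_of_mem hz hy) i j s hs
  have h2 := (sameSide_of_mem hz haR) i j s hs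
  have h3 := mem_arrCompl_iff.1 (connectedComponentIn_subset _ _ hy) i j s hs
  have h4 := (lt_of_mem_alcove ha hs).not_gt
  exact lt_of_le_of_ne (not_lt.1 fun h => h4 (h2.1 (h1.2 h))) h3.symm

/-- For `s ∈ S_{i,j}^+` the base region lies on the side `x_i - x_j < s`, so separation from it can
be read off a single point of the region. -/
theorem gpsLabel_eq {x : Fin n → ℝ} (hx : x ∈ arrCompl S) (i : Fin n) :
    gpsLabel S (connectedComponentIn (arrCompl S) x) i = (crossed S x i).card := by
  rw [gpsLabel, ← Set.ncard_coe_finset]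
  congr 1
  ext ⟨j, s⟩
  simp only [Set.mem_ofPred_eq, Finset.mem_coe, mem_crossed]
  refine and_congr_right fun hs => ?_
  obtain ⟨a, ha⟩ := alcove_nonempty n
  have haR := (baseRegion_mem S).2 ha
  have hxR := mem_connectedComponentIn hx
  constructor
  · rintro (⟨-, h⟩ | ⟨h, -⟩)
    · have h1 := h a haR
      have h2 := lt_of_mem_alcove ha hs
      push_cast at h1
      linarith
    · have := h x hxR
      push_cast at this
      linarith
  · intro h
    refine Or.inr ⟨fun z hz => ?_, fun y hy => ?_⟩
    · have := (sameSide_of_mem hx hz i j s hs).1 h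
      push_cast
      linarith
    · have := lt_of_mem_baseRegion hy hs
      push_cast
      linarith

/-! ### Labels are parking functions -/

theorem sum_multigraph (U : Finset (Fin n)) (u : Fin n) :
    ∑ v : Option (Fin n) with v ∉ U.image some, multigraph S (some u) v
      = (∑ v with v ∉ U, (plusSet S u v).card) + 1 := by
  rw [Finset.sum_filter, Fintype.sum_option, Finset.sum_filter, add_comm]
  simp [multigraph]

theorem card_filter_plusSet (V : Finset (Fin n)) (u : Fin n) :
    ((Finset.univ ×ˢ Finset.range (maxShift S + 1)).filter
      fun q : Fin n × ℕ => q.1 ∈ V ∧ q.2 ∈ plusSet S u q.1).card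
      = ∑ v ∈ V, (plusSet S u v).card := by
  rw [← Finset.card_sigma]
  refine Finset.card_nbij' (fun q => ⟨q.1, q.2⟩) (fun q => (q.1, q.2)) ?_ ?_ ?_ ?_
  · intro q hq
    simpa using (Finset.mem_filter.1 hq).2
  · rintro ⟨v, s⟩ hq
    have hq : v ∈ V ∧ s ∈ plusSet S u v := by simpa using hq
    simpa [Nat.lt_succ_iff] using ⟨le_maxShift hq.2, hq⟩
  · intro q _; rfl
  · intro q _; rfl

/-- Take `u ∈ U` with `x u` minimal. A crossed pair `(v, s)` at `u` has `x v < x u`, hence `v ∉ U`;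
the extra arc to `n+1` makes the inequality strict. -/
theorem crossed_card_mem_park (x : Fin n → ℝ) : (fun i => (crossed S x i).card) ∈ Park S := by
  intro U hU
  obtain ⟨u, hu, hmin⟩ := Finset.exists_min_image U x hU
  refine ⟨u, hu, ?_⟩
  rw [sum_multigraph, ← card_filter_plusSet, Nat.lt_succ_iff]
  refine Finset.card_le_card fun q hq => ?_
  rw [crossed, Finset.mem_filter] at hq
  rw [Finset.mem_filter]
  refine ⟨hq.1, ?_, hq.2.1⟩
  rw [Finset.mem_filter]
  refine ⟨Finset.mem_univ _, fun hU' => ?_⟩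
  have h1 := hmin q.1 hU'
  have h2 : (0 : ℝ) ≤ q.2 := Nat.cast_nonneg _
  linarith [hq.2.2]

/-! ### Injectivity of the labeling -/

/-- If `H_{l,k,d}` separates `x` from `y` and the labels of `x` and `y` agree at `l`, then a
separating hyperplane through `k` and an index `l'` with `x_{l'} < x_l` exists. -/
theorem Coherent.exists_separating (hZ : Coherent S) {x y : Fin n → ℝ} (hy : y ∈ arrCompl S)
    {l k : Fin n} {d : ℕ} (hcard : (crossed S x l).card = (crossed S y l).card)
    (hd : d ∈ plusSet S l k) (hxd : x l < x k + d) (hyd : y k + d < y l) :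
    ∃ (l' : Fin n) (d' : ℕ), x l' < x l ∧
      ((d' ∈ plusSet S l' k ∧ x l' < x k + d' ∧ y k + d' < y l') ∨
        (d' ∈ plusSet S k l' ∧ y k < y l' + d' ∧ x l' + d' < x k)) := by
  -- The point `y` crosses `(k, d)` at `l` and `x` does not; since the counts agree, `x` must cross
  -- some pair that `y` does not.
  obtain ⟨⟨l', q⟩, hqx, hqy⟩ : ∃ q ∈ crossed S x l, q ∉ crossed S y l := by
    by_contra hc
    push Not at hc
    have heq := Finset.eq_of_subset_of_card_le hc hcard.ge
    have hmem : (k, d) ∈ crossed S y l := mem_crossed.2 ⟨hd, hyd⟩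
    rw [← heq] at hmem
    exact hxd.not_gt (mem_crossed.1 hmem).2
  obtain ⟨hq, hqx⟩ := mem_crossed.1 hqx
  simp only at hq hqx
  have hqy : y l < y l' + q :=
    lt_of_le_of_ne (not_lt.1 fun h => hqy (mem_crossed.2 ⟨hq, h⟩))
      (mem_arrCompl_iff.1 hy l l' q hq).symm
  have hq0 : (0 : ℝ) ≤ q := Nat.cast_nonneg q
  have hne : l' ≠ k := by
    rintro rfl
    linarith
  have hlt : x l' < x l := by linarith
  -- Subtracting the inequalities for `(l', q)` and `(k, d)` shows that `x` and `y` are separated by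
  -- `x_{l'} - x_k = d - q`. Coherence puts this hyperplane in the arrangement, oriented by the sign
  -- of `d - q`.
  by_cases hc : q < d ∨ (q = d ∧ k < l')
  · obtain ⟨e, rfl⟩ : ∃ e, d = q + e := Nat.exists_eq_add_of_le (by omega)
    push_cast at hxd hyd
    exact ⟨l', e, hlt, Or.inl ⟨hZ l l' k q e hne hq hd (hc.imp (by omega) fun h => h.2),
      by linarith, by linarith⟩⟩
  · have hc' : d < q ∨ (q = d ∧ l' < k) := by
      rcases lt_trichotomy q d with h | h | h
      · exact absurd (Or.inl h) hc
      · exact Or.inr ⟨h, lt_of_le_of_ne (not_lt.1 fun h' => hc (Or.inr ⟨h, h'⟩)) hne⟩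
      · exact Or.inl h
    obtain ⟨e, rfl⟩ : ∃ e, q = d + e := Nat.exists_eq_add_of_le (by omega)
    push_cast at hqx hqy
    exact ⟨l', e, hlt, Or.inr ⟨hZ l k l' d e hne.symm hd hq (hc'.imp (by omega) fun h => h.2),
      by linarith, by linarith⟩⟩

/-- Descent on ordered pairs `c` such that a hyperplane in the coordinates `c.1`, `c.2` separates
`x` (on the side where `x c.1 - x c.2` is smaller) from `y`. `Coherent.exists_separating` replaces
`c.1` by an index with smaller `x`, or, with `x` and `y` exchanged, `c.2` by one with smaller `y`;
so `x c.1 + y c.2` has no minimum. -/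
theorem Coherent.sameSide (hZ : Coherent S) {x y : Fin n → ℝ} (hx : x ∈ arrCompl S)
    (hy : y ∈ arrCompl S) (hcard : ∀ i, (crossed S x i).card = (crossed S y i).card) :
    SameSide S x y := by
  set D : Fin n × Fin n → Prop := fun c => ∃ d : ℕ,
    (d ∈ plusSet S c.1 c.2 ∧ x c.1 < x c.2 + d ∧ y c.2 + d < y c.1) ∨
      (d ∈ plusSet S c.2 c.1 ∧ y c.2 < y c.1 + d ∧ x c.1 + d < x c.2) with hD
  have hempty : ∀ c, ¬ D c := by
    by_contra hc
    push Not at hc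
    obtain ⟨c, hc, hmin⟩ := (Set.toFinite {c | D c}).exists_minimalFor
      (fun c => x c.1 + y c.2) _ hc
    obtain ⟨d, ⟨h1, h2, h3⟩ | ⟨h1, h2, h3⟩⟩ := hc
    · obtain ⟨l', d', hlt, h⟩ := hZ.exists_separating hy (hcard c.1) h1 h2 h3
      have := hmin (j := (l', c.2)) ⟨d', h⟩ (by simp only; linarith)
      simp only at this
      linarith
    · obtain ⟨l', d', hlt, h⟩ := hZ.exists_separating hx (hcard c.2).symm h1 h2 h3
      have := hmin (j := (c.1, l')) ⟨d', h.symm⟩ (by simp only; linarith)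
      simp only at this
      linarith
  have key := fun (z : Fin n → ℝ) (hz : z ∈ arrCompl S) i j s hs (h : ¬ z j + (s : ℕ) < z i) =>
    lt_of_le_of_ne (not_lt.1 h) (mem_arrCompl_iff.1 hz i j s hs).symm
  intro i j s hs
  constructor
  · intro h
    by_contra hn
    exact hempty (j, i) ⟨s, Or.inr ⟨hs, key y hy i j s hs hn, h⟩⟩
  · intro h
    by_contra hn
    exact hempty (i, j) ⟨s, Or.inl ⟨hs, key x hx i j s hs hn, h⟩⟩

theorem Coherent.injOn (hZ : Coherent S) : Set.InjOn (gpsLabel S) (regions S) := by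
  rintro _ ⟨x, hx, rfl⟩ _ ⟨y, hy, rfl⟩ h
  refine connectedComponentIn_eq (mem_of_sameSide hx hy (hZ.sameSide hx hy fun i => ?_))
  rw [← gpsLabel_eq hx, ← gpsLabel_eq hy, h]

theorem mapsTo_gpsLabel : Set.MapsTo (gpsLabel S) (regions S) (Park S) := by
  rintro _ ⟨x, hx, rfl⟩
  convert crossed_card_mem_park (S := S) x using 1
  exact funext (gpsLabel_eq hx)

/-! ### Necessity of coherence for injectivity -/

theorem add_lt_add_iff_of_small {a b c : ℤ} {δ δ' : ℝ} (h : |δ| ≤ 1 / 4) (h' : |δ'| ≤ 1 / 4) :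
    (b : ℝ) + δ' + (c : ℝ) < a + δ ↔ b + c < a ∨ (b + c = a ∧ δ' < δ) := by
  rw [abs_le] at h h'
  constructor
  · intro hlt
    have h1 : b + c < a + 1 := by
      have : ((b + c : ℤ) : ℝ) < ((a + 1 : ℤ) : ℝ) := by push_cast; linarith
      exact_mod_cast this
    rcases (Int.lt_add_one_iff.1 h1).lt_or_eq with h2 | h2
    · exact Or.inl h2
    · refine Or.inr ⟨h2, ?_⟩
      have : (b : ℝ) + c = a := by exact_mod_cast h2
      linarith
  · rintro (h1 | ⟨h1, h2⟩)
    · have : (b : ℝ) + c + 1 ≤ a := by exact_mod_cast h1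
      linarith
    · have : (b : ℝ) + c = a := by exact_mod_cast h1
      linarith

/-- If `d ∉ S_{j,k}^+`, a suitable point lies on `H_{i,j,s}` and `H_{i,k,s+d}` and on no other
hyperplane. Of the four regions around it, consider the two opposite ones in which exactly one of
these hyperplanes is crossed. Both hyperplanes count towards coordinate `i`, so the labels agree. -/
theorem coherent_of_injOn (hinj : Set.InjOn (gpsLabel S) (regions S)) : Coherent S := by
  intro i j k s d hjk hs ht hd
  by_contra hn
  have hij := ne_of_mem_plusSet hs
  have hik := ne_of_mem_plusSet ht
  have hsm := le_maxShift hs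
  have htm := le_maxShift ht
  -- The remaining coordinates are spaced so widely that their differences from each other and from
  -- the three special ones exceed `maxShift S`.
  set f : Fin n → ℤ := fun a => if a = i then 0 else if a = j then -s else if a = k then -(s + d : ℕ)
    else ((a : ℤ) + 1) * (2 * maxShift S + 2) with hf
  have fi : f i = 0 := by simp [hf]
  have fj : f j = -s := by simp [hf, hij.symm]
  have fk : f k = -(s + d : ℕ) := by simp [hf, hik.symm, hjk.symm]
  have fo : ∀ a, a ≠ i → a ≠ j → a ≠ k → f a = ((a : ℤ) + 1) * (2 * maxShift S + 2) := by
    intro a h1 h2 h3; simp [hf, h1, h2, h3]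
  have fo' : ∀ a, a ≠ i → a ≠ j → a ≠ k → 2 * (maxShift S : ℤ) + 2 ≤ f a := by
    intro a h1 h2 h3
    rw [fo a h1 h2 h3]
    nlinarith [Int.natCast_nonneg (a : ℕ), Int.natCast_nonneg (maxShift S)]
  have fle : ∀ a, a = i ∨ a = j ∨ a = k → -(maxShift S : ℤ) ≤ f a ∧ f a ≤ 0 := by
    rintro a (rfl | rfl | rfl)
    · rw [fi]; omega
    · rw [fj]; omega
    · rw [fk]; omega
  have only : ∀ a b : Fin n, ∀ r : ℕ, r ∈ plusSet S a b → f b + r = f a →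
      a = i ∧ ((b = j ∧ r = s) ∨ (b = k ∧ r = s + d)) := by
    intro a b r hr he
    have hrm := le_maxShift hr
    have hab := ne_of_mem_plusSet hr
    have hdir := pos_or_lt_of_mem_plusSet hr
    have hdirs := pos_or_lt_of_mem_plusSet hs
    have hdirt := pos_or_lt_of_mem_plusSet ht
    by_cases ha : a = i ∨ a = j ∨ a = k
    · by_cases hb : b = i ∨ b = j ∨ b = k
      · rcases ha with rfl | rfl | rfl <;> rcases hb with rfl | rfl | rfl
        · exact absurd rfl hab
        · rw [fi, fj] at he
          exact ⟨rfl, Or.inl ⟨rfl, by omega⟩⟩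
        · rw [fi, fk] at he
          exact ⟨rfl, Or.inr ⟨rfl, by omega⟩⟩
        · rw [fi, fj] at he; omega
        · exact absurd rfl hab
        · rw [fj, fk] at he
          obtain rfl : r = d := by omega
          exact absurd hr hn
        · rw [fi, fk] at he; omega
        · rw [fj, fk] at he; omega
        · exact absurd rfl hab
      · push Not at hb
        have h1 := fo' b hb.1 hb.2.1 hb.2.2
        have h2 := (fle a ha).2
        omega
    · push Not at ha
      by_cases hb : b = i ∨ b = j ∨ b = k
      · have h1 := fo' a ha.1 ha.2.1 ha.2.2
        have h2 := (fle b hb).2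
        omega
      · push Not at hb
        rw [fo a ha.1 ha.2.1 ha.2.2, fo b hb.1 hb.2.1 hb.2.2] at he
        exfalso
        have hne : (a : ℤ) ≠ b := fun h => hab (Fin.ext (by exact_mod_cast h))
        rcases lt_or_gt_of_ne hne with h | h
        · nlinarith [Int.natCast_nonneg (maxShift S), Int.natCast_nonneg r]
        · nlinarith [Int.natCast_nonneg (maxShift S), Int.natCast_nonneg r]
  -- For `e = 1/4` only `H_{i,k,s+d}` of the two is crossed, for `e = -1/4` only `H_{i,j,s}`.
  set pt : ℝ → Fin n → ℝ := fun e a => (f a : ℝ) + if a = j then e else if a = k then -e else 0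
    with hpt
  have hδ : ∀ e : ℝ, |e| ≤ 1 / 4 → ∀ a : Fin n,
      |if a = j then e else if a = k then -e else 0| ≤ 1 / 4 := by
    intro e he a
    split_ifs
    · exact he
    · rwa [abs_neg]
    · norm_num
  have hlt : ∀ e : ℝ, |e| ≤ 1 / 4 → ∀ (a b : Fin n) (r : ℕ), pt e b + r < pt e a ↔
      f b + r < f a ∨ (f b + r = f a ∧ (if b = j then e else if b = k then -e else 0) <
        (if a = j then e else if a = k then -e else 0)) := by
    intro e he a b r
    rw [← add_lt_add_iff_of_small (hδ e he a) (hδ e he b)]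
    simp only [hpt]
    push_cast
    rfl
  have hcompl : ∀ e : ℝ, |e| ≤ 1 / 4 → e ≠ 0 → pt e ∈ arrCompl S := by
    intro e he he0
    rw [mem_arrCompl_iff]
    intro a b r hr heq
    have h1 := (abs_le.1 (hδ e he a))
    have h2 := (abs_le.1 (hδ e he b))
    simp only [hpt] at heq
    have h3 : f b + r = f a := by
      have h3 : ((f b + r : ℤ) : ℝ) < ((f a + 1 : ℤ) : ℝ) := by push_cast; linarith
      have h4 : ((f a : ℤ) : ℝ) < ((f b + r + 1 : ℤ) : ℝ) := by push_cast; linarith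
      norm_cast at h3 h4
      omega
    obtain ⟨rfl, ⟨rfl, -⟩ | ⟨rfl, -⟩⟩ := only a b r hr h3
    · simp only [if_true, if_neg hij, if_neg hik] at heq
      have : (f b : ℝ) + r = f a := by exact_mod_cast h3
      exact he0 (by linarith)
    · simp only [if_true, if_neg hij, if_neg hik, if_neg hjk.symm] at heq
      have : (f b : ℝ) + r = f a := by exact_mod_cast h3
      exact he0 (by linarith)
  set C : Fin n → Finset (Fin n × ℕ) := fun a =>
    (Finset.univ ×ˢ Finset.range (maxShift S + 1)).filter
      fun q => q.2 ∈ plusSet S a q.1 ∧ f q.1 + q.2 < f a with hC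
  have memC : ∀ a q, q ∈ C a ↔ q.2 ∈ plusSet S a q.1 ∧ f q.1 + q.2 < f a := by
    intro a q
    simp only [hC]
    rw [Finset.mem_filter, and_iff_right_iff_imp]
    intro h
    simpa [Nat.lt_succ_iff] using le_maxShift h.1
  have hother : ∀ e : ℝ, |e| ≤ 1 / 4 → ∀ a, a ≠ i → crossed S (pt e) a = C a := by
    intro e he a ha
    ext q
    rw [mem_crossed, memC, hlt e he]
    refine and_congr_right fun hq => or_iff_left ?_
    rintro ⟨h1, -⟩
    exact ha (only a q.1 q.2 hq h1).1
  have hpos : crossed S (pt (1 / 4)) i = insert (k, s + d) (C i) := by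
    ext ⟨b, r⟩
    rw [mem_crossed, Finset.mem_insert, memC, hlt _ (by norm_num [abs_of_pos]), Prod.mk.injEq]
    simp only [if_neg hij, if_neg hik]
    constructor
    · rintro ⟨hq, h | ⟨h, h'⟩⟩
      · exact Or.inr ⟨hq, h⟩
      · obtain ⟨-, ⟨rfl, -⟩ | h2⟩ := only i b r hq h
        · norm_num at h'
        · exact Or.inl h2
    · rintro (⟨rfl, rfl⟩ | ⟨hq, h⟩)
      · refine ⟨ht, Or.inr ⟨by rw [fi, fk]; omega, ?_⟩⟩
        rw [if_neg hjk.symm, if_pos rfl]; norm_num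
      · exact ⟨hq, Or.inl h⟩
  have hneg : crossed S (pt (-(1 / 4))) i = insert (j, s) (C i) := by
    ext ⟨b, r⟩
    rw [mem_crossed, Finset.mem_insert, memC, hlt _ (by norm_num [abs_of_pos]), Prod.mk.injEq]
    simp only [if_neg hij, if_neg hik]
    constructor
    · rintro ⟨hq, h | ⟨h, h'⟩⟩
      · exact Or.inr ⟨hq, h⟩
      · obtain ⟨-, h2 | ⟨rfl, -⟩⟩ := only i b r hq h
        · exact Or.inl h2
        · rw [if_neg hjk.symm, if_pos rfl] at h'; norm_num at h'
    · rintro (⟨rfl, rfl⟩ | ⟨hq, h⟩)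
      · refine ⟨hs, Or.inr ⟨by rw [fi, fj]; omega, ?_⟩⟩
        rw [if_pos rfl]; norm_num
      · exact ⟨hq, Or.inl h⟩
  have hx := hcompl (1 / 4) (by norm_num [abs_of_pos]) (by norm_num)
  have hy := hcompl (-(1 / 4)) (by norm_num [abs_of_pos]) (by norm_num)
  have heq := hinj ⟨_, hx, rfl⟩ ⟨_, hy, rfl⟩ (by
    funext a
    rw [gpsLabel_eq hx, gpsLabel_eq hy]
    by_cases ha : a = i
    · subst ha
      rw [hpos, hneg, Finset.card_insert_of_notMem, Finset.card_insert_of_notMem]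
      · rw [memC]
        simp only [fi, fj]
        omega
      · rw [memC]
        simp only [fi, fk]
        omega
    · rw [hother _ (by norm_num [abs_of_pos]) a ha, hother _ (by norm_num [abs_of_pos]) a ha])
  have hmem : pt (-(1 / 4)) ∈ connectedComponentIn (arrCompl S) (pt (1 / 4)) := by
    rw [heq]; exact mem_connectedComponentIn hy
  have h1 := (sameSide_of_mem hx hmem i j s hs).2
    (mem_crossed.1 (by rw [hneg]; exact Finset.mem_insert_self _ _)).2
  have h2 : (j, s) ∈ crossed S (pt (1 / 4)) i := mem_crossed.2 ⟨hs, h1⟩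
  rw [hpos, Finset.mem_insert, memC, Prod.mk.injEq] at h2
  rcases h2 with h2 | h2
  · exact hjk h2.1
  · simp only [fi, fj] at h2
    omega

/-! ### Words -/

section Words

variable {α : Type}

theorem before_iff {w : List α} {a b : α} :
    Before w a b ↔ ∃ u v, w = u ++ b :: v ∧ a ∈ u := by
  constructor
  · rintro ⟨p, q, hpq, hp, hq⟩
    obtain ⟨hp', rfl⟩ := List.getElem?_eq_some_iff.1 hp
    obtain ⟨hq', rfl⟩ := List.getElem?_eq_some_iff.1 hq
    refine ⟨w.take q, w.drop (q + 1), ?_, ?_⟩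
    · rw [← List.drop_eq_getElem_cons hq', List.take_append_drop]
    · exact List.mem_take_iff_getElem.2 ⟨p, by omega, rfl⟩
  · rintro ⟨u, v, rfl, ha⟩
    obtain ⟨p, hp, rfl⟩ := List.mem_iff_getElem.1 ha
    refine ⟨p, u.length, hp, ?_, ?_⟩
    · rw [List.getElem?_append_left hp, List.getElem?_eq_getElem hp]
    · simp

theorem followedBy_iff {w : List α} {a b : α} :
    FollowedBy w a b ↔ ∃ u v, w = u ++ a :: b :: v := by
  constructor
  · rintro ⟨p, hp, hq⟩
    obtain ⟨hp', rfl⟩ := List.getElem?_eq_some_iff.1 hp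
    obtain ⟨hq', rfl⟩ := List.getElem?_eq_some_iff.1 hq
    refine ⟨w.take p, w.drop (p + 1 + 1), ?_⟩
    rw [← List.drop_eq_getElem_cons hq', ← List.drop_eq_getElem_cons hp', List.take_append_drop]
  · rintro ⟨u, v, rfl⟩
    exact ⟨u.length, by simp, by simp⟩

theorem Before.append {u : List α} {a b : α} (h : Before u a b) (v : List α) :
    Before (u ++ v) a b := by
  obtain ⟨u1, v1, rfl, ha⟩ := before_iff.1 h
  exact before_iff.2 ⟨u1, v1 ++ v, by simp, ha⟩

theorem Before.right_mem {u : List α} {a b : α} (h : Before u a b) : b ∈ u := by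
  obtain ⟨u1, v1, rfl, ha⟩ := before_iff.1 h
  simp

theorem Before.left_mem {u : List α} {a b : α} (h : Before u a b) : a ∈ u := by
  obtain ⟨u1, v1, rfl, ha⟩ := before_iff.1 h
  exact List.mem_append_left _ ha

theorem append_singleton_eq_append_cons {u u1 v : List α} {a c : α}
    (h : u ++ [c] = u1 ++ a :: v) :
    (u1 = u ∧ a = c ∧ v = []) ∨ ∃ v', v = v' ++ [c] ∧ u = u1 ++ a :: v' := by
  rcases List.eq_nil_or_concat v with rfl | ⟨v', d, rfl⟩
  · obtain ⟨rfl, h2⟩ := List.append_inj' h rfl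
    exact Or.inl ⟨rfl, by simpa using h2.symm, rfl⟩
  · have h' : u ++ [c] = (u1 ++ a :: v') ++ [d] := by simpa using h
    obtain ⟨h1, h2⟩ := List.append_inj' h' rfl
    obtain rfl : c = d := by simpa using h2
    exact Or.inr ⟨v', by simp, h1⟩

theorem before_append_singleton {u : List α} {a b c : α} :
    Before (u ++ [c]) a b ↔ Before u a b ∨ (a ∈ u ∧ b = c) := by
  constructor
  · intro h
    obtain ⟨u1, v1, he, ha⟩ := before_iff.1 h
    rcases append_singleton_eq_append_cons he with ⟨rfl, rfl, rfl⟩ | ⟨v', rfl, rfl⟩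
    · exact Or.inr ⟨ha, rfl⟩
    · exact Or.inl (before_iff.2 ⟨u1, v', rfl, ha⟩)
  · rintro (h | ⟨h, rfl⟩)
    · exact h.append _
    · exact before_iff.2 ⟨u, [], rfl, h⟩

theorem followedBy_append_singleton {u : List α} {a b c : α} (h : FollowedBy (u ++ [c]) a b) :
    FollowedBy u a b ∨ (u.getLast? = some a ∧ b = c) := by
  obtain ⟨u1, v1, he⟩ := followedBy_iff.1 h
  rcases append_singleton_eq_append_cons he with ⟨-, -, h3⟩ | ⟨v', hv, rfl⟩
  · simp at h3
  · rcases v' with _ | ⟨d, v'⟩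
    · simp only [List.nil_append, List.cons.injEq] at hv
      exact Or.inr ⟨by simp, hv.1⟩
    · simp only [List.cons_append, List.cons.injEq] at hv
      rw [← hv.1]
      exact Or.inl (followedBy_iff.2 ⟨u1, v', rfl⟩)

theorem append_cons_inj_of_nodup {u u' v v' : List α} {a : α} (hw : (u ++ a :: v).Nodup)
    (h : u ++ a :: v = u' ++ a :: v') : u = u' ∧ v = v' := by
  have h1 : a ∉ u := fun hm => (List.nodup_append.1 hw).2.2 a hm a (by simp) rfl
  have h2 : a ∉ v := (List.nodup_cons.1 (List.nodup_append.1 hw).2.1).1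
  exact ((List.append_cons_inj_of_notMem h1 h2).1 h).imp id And.right

theorem Before.mem_of_nodup {u v : List α} {a b : α} (hw : (u ++ b :: v).Nodup)
    (h : Before (u ++ b :: v) a b) : a ∈ u := by
  obtain ⟨u1, v1, he, ha⟩ := before_iff.1 h
  rwa [(append_cons_inj_of_nodup hw he).1]

theorem before_or_before {u : List α} {a b : α} (ha : a ∈ u) (hb : b ∈ u) (hab : a ≠ b) :
    Before u a b ∨ Before u b a := by
  obtain ⟨u1, v1, rfl⟩ := List.append_of_mem ha
  rcases List.mem_append.1 hb with h | h
  · exact Or.inr (before_iff.2 ⟨u1, v1, rfl, h⟩)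
  · obtain ⟨u2, v2, rfl⟩ := List.append_of_mem ((List.mem_cons.1 h).resolve_left hab.symm)
    exact Or.inl (before_iff.2 ⟨u1 ++ a :: u2, v2, by simp, by simp⟩)

theorem Before.asymm_of_nodup {u : List α} {a b : α} (hu : u.Nodup) (h : Before u a b) :
    ¬ Before u b a := by
  intro h'
  obtain ⟨u1, v1, rfl, ha⟩ := before_iff.1 h
  obtain ⟨u2, v2, rfl⟩ := List.append_of_mem ha
  rw [List.append_assoc, List.cons_append] at h' hu
  have := h'.mem_of_nodup hu
  exact (List.nodup_append.1 hu).2.2 b this b (by simp) rfl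

end Words

/-! ### Elementary properties of sketches -/

theorem IsSketch.toFinset_eq {m : ℕ} {w : List (Fin n × ℕ)} (hw : IsSketch m w) :
    w.toFinset = Finset.univ ×ˢ Finset.range (m + 1) := by
  ext ⟨i, s⟩
  simp [hw.mem_iff i s]

theorem IsSketch.nodup {m : ℕ} {w : List (Fin n × ℕ)} (hw : IsSketch m w) : w.Nodup := by
  rw [← Multiset.coe_nodup, ← Multiset.toFinset_card_eq_card_iff_nodup]
  show w.toFinset.card = w.length
  rw [hw.toFinset_eq, hw.length_eq, Finset.card_product]
  simp [mul_comm]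

theorem IsSketch.pred_mem {m : ℕ} {w u v : List (Fin n × ℕ)} {k : Fin n} {s : ℕ}
    (hw : IsSketch m w) (h : w = u ++ (k, s + 1) :: v) : (k, s) ∈ u := by
  have hm : (k, s + 1) ∈ w := by rw [h]; simp
  have hb := hw.before_succ k (s + 1) (by omega) ((hw.mem_iff k _).1 hm)
  have hn := hw.nodup
  rw [h] at hb hn
  exact hb.mem_of_nodup hn

theorem IsSketch.zero_mem {m : ℕ} {w u v : List (Fin n × ℕ)} {k : Fin n} {s : ℕ}
    (hw : IsSketch m w) (h : w = u ++ v) (hs : (k, s) ∈ u) : (k, 0) ∈ u := by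
  induction s with
  | zero => exact hs
  | succ s ih =>
    obtain ⟨u1, u2, rfl⟩ := List.append_of_mem hs
    have := hw.pred_mem (u := u1) (v := u2 ++ v) (k := k) (s := s) (by simpa using h)
    exact ih (List.mem_append_left _ this)

/-- The number of letters `α_j^s` of the word with `s ∈ S_{i,j}^+`. -/
def cnt (S : Fin n → Fin n → Finset ℤ) (i : Fin n) (u : List (Fin n × ℕ)) : ℕ :=
  u.countP fun a => a.2 ∈ plusSet S i a.1

theorem cnt_append (i : Fin n) (u v : List (Fin n × ℕ)) :
    cnt S i (u ++ v) = cnt S i u + cnt S i v := List.countP_append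

theorem cnt_eq_card {i : Fin n} {u : List (Fin n × ℕ)} (hu : u.Nodup) :
    cnt S i u = (u.toFinset.filter fun a => a.2 ∈ plusSet S i a.1).card := by
  rw [cnt, List.countP_eq_length_filter, ← List.toFinset_card_of_nodup (hu.filter _),
    List.toFinset_filter]
  simp

/-- The words which could be written by the process `Ψ` starting from `p`, as far as the choice
between the two cases of the process is concerned. -/
def Follows (S : Fin n → Fin n → Finset ℤ) (p : Fin n → ℕ) (w : List (Fin n × ℕ)) : Prop :=
  ∀ u a v, w = u ++ a :: v → (a.2 = 0 → cnt S a.1 u = p a.1) ∧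
    ∀ i, (i, 0) ∉ u → (1 ≤ a.2 ∨ a.1 < i) → cnt S i u < p i

/-- After a common prefix the next letter is forced: `p` decides whether it is some `α_k^0` and
which one, and otherwise the shift axiom of sketches decides, as a first-in first-out rule. -/
theorem IsSketch.eq_of_follows {m : ℕ} {w w' : List (Fin n × ℕ)} {p : Fin n → ℕ}
    (hw : IsSketch m w) (hw' : IsSketch m w') (h : Follows S p w) (h' : Follows S p w') :
    w = w' := by
  suffices key : ∀ v u v', w = u ++ v → w' = u ++ v' → v = v' by
    exact key w [] w' rfl rfl
  have fifo : ∀ {z z' u v v' : List (Fin n × ℕ)} {k k' : Fin n} {s s' : ℕ}, IsSketch m z →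
      IsSketch m z' → z = u ++ (k, s + 1) :: v → z' = u ++ (k', s' + 1) :: v' →
      Before u (k, s) (k', s') → False := by
    intro z z' u v v' k k' s s' hz hz' he he' hb
    have hm : (k, s + 1) ∈ z := by rw [he]; simp
    have hm' : (k', s' + 1) ∈ z' := by rw [he']; simp
    have hb' : Before z' (k, s) (k', s') := by rw [he']; exact hb.append _
    have := hz'.before_shift k k' (s + 1) (s' + 1) (by omega) ((hz.mem_iff _ _).1 hm) (by omega)
      ((hz'.mem_iff _ _).1 hm') hb'
    have hn := hz.nodup
    have hn' := hz'.nodup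
    rw [he'] at this hn'
    rw [he] at hn
    exact (List.nodup_append.1 hn).2.2 _ (this.mem_of_nodup hn') _ (by simp) rfl
  intro v
  induction v with
  | nil =>
    intro u v' he he'
    have h1 := hw.length_eq
    have h2 := hw'.length_eq
    rw [he] at h1
    rw [he'] at h2
    simp only [List.length_append, List.length_nil] at h1 h2
    exact (List.length_eq_zero_iff.1 (by omega)).symm
  | cons a v ih =>
    intro u v' he he'
    rcases v' with _ | ⟨b, v'⟩
    · have h1 := hw.length_eq
      have h2 := hw'.length_eq
      rw [he] at h1
      rw [he'] at h2
      simp only [List.length_append, List.length_nil, List.length_cons] at h1 h2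
      omega
    · have hn := hw.nodup
      have hn' := hw'.nodup
      rw [he] at hn
      rw [he'] at hn'
      have ha : a ∉ u := fun hm => (List.nodup_append.1 hn).2.2 a hm a (by simp) rfl
      have hb : b ∉ u := fun hm => (List.nodup_append.1 hn').2.2 b hm b (by simp) rfl
      have h1 := h u a v he
      have h2 := h' u b v' he'
      have hab : a = b := by
        obtain ⟨k, s⟩ := a
        obtain ⟨k', s'⟩ := b
        simp only at h1 h2
        rcases s with _ | s
        · have e1 := h1.1 rfl
          rcases s' with _ | s'
          · have e2 := h2.1 rfl
            rcases lt_trichotomy k k' with hlt | rfl | hlt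
            · have := h1.2 k' hb (Or.inr hlt)
              omega
            · rfl
            · have := h2.2 k ha (Or.inr hlt)
              omega
          · have := h2.2 k ha (Or.inl (by omega))
            omega
        · rcases s' with _ | s'
          · have e2 := h2.1 rfl
            have := h1.2 k' hb (Or.inl (by omega))
            omega
          · by_contra hne
            have hp := hw.pred_mem he
            have hp' := hw'.pred_mem he'
            have hne' : (k, s) ≠ (k', s') := by
              rintro h
              simp only [Prod.mk.injEq] at h
              exact hne (by rw [h.1, h.2])
            rcases before_or_before hp hp' hne' with hbb | hbb
            · exact fifo hw hw' he he' hbb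
            · exact fifo hw' hw he' he hbb
      subst hab
      rw [ih (u ++ [a]) v' (by simpa using he) (by simpa using he')]

/-! ### Sketches in `M_S` follow their label -/

/-- The label of a word: the `i`-th entry counts the letters `α_j^s` with `s ∈ S_{i,j}^+` that occur
before `α_i^0`. -/
def wordLabel (S : Fin n → Fin n → Finset ℤ) (w : List (Fin n × ℕ)) (i : Fin n) : ℕ :=
  cnt S i (w.takeWhile fun a => a ≠ (i, 0))

theorem wordLabel_eq {w u v : List (Fin n × ℕ)} {i : Fin n} (hw : w.Nodup)
    (h : w = u ++ (i, 0) :: v) : wordLabel S w i = cnt S i u := by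
  subst h
  have hu : (i, 0) ∉ u := fun hm => (List.nodup_append.1 hw).2.2 _ hm (i, 0) (by simp) rfl
  rw [wordLabel, List.takeWhile_append_of_pos, List.takeWhile_cons_of_neg (by simp),
    List.append_nil]
  intro a ha
  simp only [ne_eq, decide_not, Bool.not_eq_eq_eq_not, Bool.not_true, decide_eq_false_iff_not]
  rintro rfl
  exact hu ha

/-- Walk back from `α_j^0`. By membership in `M` and (X), the preceding letter either is counted for
`i` or is some `α_{k'}^0` with `i < k'`, in which case `k'` replaces `j`. The second alternative is
excluded at the letter `(k, s)`, so the walk finds a counted letter. -/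
theorem PropertyX.exists_counted (hX : PropertyX S) {w : List (Fin n × ℕ)} (hw : w ∈ setM S)
    {u : List (Fin n × ℕ)} {k i : Fin n} {s : ℕ} (hks : 1 ≤ s ∨ k < i) :
    ∀ (v1 v2 : List (Fin n × ℕ)) (j : Fin n), w = (u ++ (k, s) :: v1) ++ (j, 0) :: v2 → i ≤ j →
      (i, 0) ∉ u ++ (k, s) :: v1 → ∃ a ∈ (k, s) :: v1, a.2 ∈ plusSet S i a.1 := by
  have step : ∀ (u v2 : List (Fin n × ℕ)) (j k : Fin n) (s : ℕ),
      w = u ++ (k, s) :: (j, 0) :: v2 → i ≤ j → (i, 0) ∉ u ++ [(k, s)] →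
      s ∈ plusSet S i k ∨ (s = 0 ∧ i < k) := by
    intro u v2 j k s he hij hi
    have hki : k ≠ i := by
      rintro rfl
      exact hi (hw.1.zero_mem (v := (j, 0) :: v2) (by simpa using he)
        (List.mem_append_right _ (List.mem_singleton_self (k, s))))
    rcases hw.2 j k s (followedBy_iff.2 ⟨u, v2, he⟩) with h | ⟨h, h'⟩
    · rcases hij.lt_or_eq with hlt | rfl
      · exact hX i j k hlt hki (ne_of_mem_plusSet h).symm s h
      · exact Or.inl h
    · exact Or.inr ⟨h, hij.trans_lt h'⟩
  intro v1
  induction v1 using List.reverseRecOn with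
  | nil =>
    intro v2 j he hij hi
    rcases step u v2 j k s (by simpa using he) hij hi with h | ⟨h, h'⟩
    · exact ⟨_, List.mem_cons_self, h⟩
    · rcases hks with h'' | h''
      · omega
      · exact absurd h' h''.asymm
  | append_singleton v1 c ih =>
    obtain ⟨k', s'⟩ := c
    intro v2 j he hij hi
    rcases step (u ++ (k, s) :: v1) v2 j k' s' (by simpa using he) hij (by simpa using hi)
      with h | ⟨rfl, h'⟩
    · exact ⟨(k', s'), by simp, h⟩
    · obtain ⟨a, ha, ha'⟩ := ih ((j, 0) :: v2) k' (by simpa using he) h'.le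
        (fun hm => hi (by
          rw [← List.cons_append, ← List.append_assoc]
          exact List.mem_append_left _ hm))
      exact ⟨a, by rw [← List.cons_append]; exact List.mem_append_left _ ha, ha'⟩

theorem PropertyX.follows (hX : PropertyX S) {w : List (Fin n × ℕ)} (hw : w ∈ setM S) :
    Follows S (wordLabel S w) w := by
  rintro u ⟨k, s⟩ v he
  refine ⟨fun h0 => ?_, fun i hi hks => ?_⟩
  · obtain rfl : s = 0 := h0
    exact (wordLabel_eq hw.1.nodup he).symm
  · have hmem : (i, 0) ∈ w := (hw.1.mem_iff i 0).2 (Nat.zero_le _)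
    rw [he] at hmem
    have hne : (i, 0) ≠ (k, s) := by
      intro h
      simp only [Prod.mk.injEq] at h
      obtain ⟨rfl, rfl⟩ := h
      simp at hks
    have hv := (List.mem_cons.1 ((List.mem_append.1 hmem).resolve_left hi)).resolve_left hne
    obtain ⟨v1, v2, rfl⟩ := List.append_of_mem hv
    have he' : w = (u ++ (k, s) :: v1) ++ (i, 0) :: v2 := by simpa using he
    have hn := hw.1.nodup
    rw [he'] at hn
    have hi' : (i, 0) ∉ u ++ (k, s) :: v1 := fun hm =>
      (List.nodup_append.1 hn).2.2 _ hm (i, 0) (by simp) rfl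
    obtain ⟨a, ha, ha'⟩ := hX.exists_counted hw hks v1 v2 i he' le_rfl hi'
    rw [wordLabel_eq hw.1.nodup he', cnt_append]
    have : 0 < cnt S i ((k, s) :: v1) := List.countP_pos_iff.2 ⟨a, ha, by simpa using ha'⟩
    omega

/-! ### The process `Ψ` -/

/-- The letters of `u` after which a letter with the same index is still to be written. -/
def pending (S : Fin n → Fin n → Finset ℤ) (u : List (Fin n × ℕ)) : List (Fin n × ℕ) :=
  u.filter fun a => a.2 < maxShift S ∧ (a.1, a.2 + 1) ∉ u

/-- The invariant of the process `Ψ` started at `p`, when the word `u` has been written and the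
current tuple and list are `P` and `O`. -/
structure RunInv (S : Fin n → Fin n → Finset ℤ) (p : Fin n → ℕ) (u : List (Fin n × ℕ))
    (P : Fin n → ℤ) (O : List (Fin n)) : Prop where
  nodup : u.Nodup
  le : ∀ a ∈ u, a.2 ≤ maxShift S
  pred : ∀ k s, (k, s + 1) ∈ u → Before u (k, s) (k, s + 1)
  fifo : ∀ a b : Fin n × ℕ, Before u a b → (b.1, b.2 + 1) ∈ u → a.2 < maxShift S →
    Before u (a.1, a.2 + 1) (b.1, b.2 + 1)
  follows : Follows S p u
  adj : ∀ i j s, FollowedBy u (j, s) (i, 0) → IsTriple S i j s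
  last : ∀ i j s, u.getLast? = some (j, s) → P i = 0 → IsTriple S i j s
  letters : ∀ i, ∃ c : ℕ, (∀ r, (i, r) ∈ u ↔ r < c) ∧ (0 < c → P i = -(c : ℤ)) ∧
    (c = 0 → P i = (p i : ℤ) - cnt S i u ∧ cnt S i u ≤ p i)
  queue : O = (pending S u).map Prod.fst

theorem RunInv.start (p : Fin n → ℕ) : RunInv S p [] (fun i => (p i : ℤ)) [] where
  nodup := List.nodup_nil
  le := by simp
  pred := by simp
  fifo := by simp
  follows := by intro u a v h; simp at h
  adj := by rintro i j s ⟨q, h, -⟩; simp at h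
  last := by simp
  letters := fun i => ⟨0, by simp, by simp, by simp [cnt]⟩
  queue := rfl

theorem RunInv.mem_iff {p : Fin n → ℕ} {u : List (Fin n × ℕ)} {P : Fin n → ℤ} {O : List (Fin n)}
    (h : RunInv S p u P O) {k : Fin n} {s : ℕ} (hP : P k = -(s : ℤ)) (r : ℕ) :
    (k, r) ∈ u ↔ r < s := by
  obtain ⟨c, h1, h2, h3⟩ := h.letters k
  rw [h1]
  rcases Nat.eq_zero_or_pos c with rfl | h0
  · have := h3 rfl
    omega
  · have := h2 h0
    omega

/-- The two cases of the process share this step: `hz` encodes the choice of the rightmost zero, or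
the absence of zeros, and `hf` the choice of the oldest pending letter. -/
theorem RunInv.step {p : Fin n → ℕ} {u : List (Fin n × ℕ)} {P : Fin n → ℤ} {O : List (Fin n)}
    (h : RunInv S p u P O) {k : Fin n} {s : ℕ} (hP : P k = -(s : ℤ)) (hs : s ≤ maxShift S)
    (hz : ∀ i, P i = 0 → s = 0 ∧ i ≤ k)
    (hf : ∀ (r : ℕ) (a : Fin n × ℕ), s = r + 1 → Before u a (k, r) → a.2 < maxShift S →
      (a.1, a.2 + 1) ∈ u) :
    RunInv S p (u ++ [(k, s)]) (psiUpdate S P k s)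
      ((pending S (u ++ [(k, s)])).map Prod.fst) := by
  have hk := h.mem_iff hP
  have hnot : (k, s) ∉ u := by rw [hk]; exact lt_irrefl s
  refine ⟨?_, ?_, ?_, ?_, ?_, ?_, ?_, ?_, rfl⟩
  · rw [List.nodup_append]
    refine ⟨h.nodup, List.nodup_singleton _, ?_⟩
    intro a ha b hb hab
    rw [List.mem_singleton] at hb
    exact hnot (by rwa [← hb, ← hab])
  · intro a ha
    rcases List.mem_append.1 ha with ha | ha
    · exact h.le a ha
    · rw [List.mem_singleton] at ha
      rw [ha]; exact hs
  · intro k' s' hm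
    rcases List.mem_append.1 hm with hm | hm
    · exact (h.pred k' s' hm).append _
    · simp only [List.mem_singleton, Prod.mk.injEq] at hm
      obtain ⟨rfl, rfl⟩ := hm
      exact before_append_singleton.2 (Or.inr ⟨(hk s').2 (by omega), rfl⟩)
  · intro a b hab hb ha
    rcases before_append_singleton.1 hab with hab' | ⟨hau, rfl⟩
    · rcases List.mem_append.1 hb with hb | hb
      · exact (h.fifo a b hab' hb ha).append _
      · simp only [List.mem_singleton, Prod.mk.injEq] at hb
        obtain ⟨rfl, hb2⟩ := hb
        exact before_append_singleton.2 (Or.inr ⟨hf b.2 a hb2.symm hab' ha, by rw [hb2]⟩)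
    · rcases List.mem_append.1 hb with hb | hb
      · rw [hk] at hb
        simp only at hb
        omega
      · simp at hb
  · intro u1 a v he
    rcases append_singleton_eq_append_cons he with ⟨rfl, rfl, -⟩ | ⟨v', -, he'⟩
    · refine ⟨fun h0 => ?_, fun i hi hor => ?_⟩
      · obtain rfl : s = 0 := h0
        obtain ⟨c, h1, h2, h3⟩ := h.letters k
        have hc : ¬ 0 < c := fun h0 => hnot ((h1 0).2 h0)
        have := h3 (by omega)
        simp only
        omega
      · obtain ⟨c, h1, h2, h3⟩ := h.letters i
        have hc : ¬ 0 < c := fun h0 => hi ((h1 0).2 h0)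
        have h3 := h3 (by omega)
        refine lt_of_le_of_ne h3.2 fun heq => ?_
        obtain ⟨h4, h5⟩ := hz i (by omega)
        rcases hor with h6 | h6
        · simp only at h6
          omega
        · exact absurd h6 h5.not_gt
    · exact h.follows u1 a v' he'
  · intro i j s' hfol
    rcases followedBy_append_singleton hfol with h1 | ⟨h1, h2⟩
    · exact h.adj i j s' h1
    · simp only [Prod.mk.injEq] at h2
      obtain ⟨rfl, rfl⟩ := h2
      exact h.last i j s' h1 (by simpa using hP)
  · intro i j s' hlast hPi
    rw [List.getLast?_concat, Option.some_inj, Prod.mk.injEq] at hlast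
    obtain ⟨rfl, rfl⟩ := hlast
    -- An entry that is zero now either was just lowered from `1`, so that `s ∈ S_{i,k}^+`, or was
    -- already a zero to the left of the chosen one, so that `s = 0` and `i < k`.
    rw [psiUpdate] at hPi
    split_ifs at hPi with hc
    · rcases hc with rfl | hc
      · omega
      · exact Or.inl hc.2
    · obtain ⟨h1, h2⟩ := hz i hPi
      exact Or.inr ⟨h1, lt_of_le_of_ne h2 fun h => hc (Or.inl h)⟩
  · intro i
    by_cases hik : i = k
    · subst hik
      refine ⟨s + 1, fun r => ?_, fun _ => ?_, fun h0 => by omega⟩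
      · simp only [List.mem_append, hk, List.mem_singleton, Prod.mk.injEq, true_and]
        omega
      · simp only [psiUpdate, true_or, if_true]
        push_cast
        omega
    · obtain ⟨c, h1, h2, h3⟩ := h.letters i
      refine ⟨c, fun r => ?_, fun h0 => ?_, fun h0 => ?_⟩
      · simp [h1, hik]
      · have := h2 h0
        rw [psiUpdate, if_neg, this]
        rintro (h' | ⟨h', -⟩)
        · exact hik h'
        · omega
      · obtain ⟨h4, h5⟩ := h3 h0
        have hcnt : cnt S i (u ++ [(k, s)]) = cnt S i u + if s ∈ plusSet S i k then 1 else 0 := by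
          rw [cnt_append]
          congr 1
          simp [cnt, List.countP_cons]
        rw [hcnt, psiUpdate]
        by_cases hmem : s ∈ plusSet S i k
        -- The positivity test in the update never blocks a counted letter here: `P i = 0` would
        -- force `s = 0` and `i ≤ k`, but `0 ∈ S_{i,k}^+` requires `k < i`.
        · have hpos : 0 < P i := by
            refine lt_of_le_of_ne (by omega) fun h0 => ?_
            obtain ⟨h6, h7⟩ := hz i h0.symm
            rcases pos_or_lt_of_mem_plusSet hmem with h8 | h8
            · omega
            · exact absurd h7 h8.not_ge
          rw [if_pos (Or.inr ⟨hpos, hmem⟩), if_pos hmem]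
          push_cast
          omega
        · rw [if_neg (by rintro (h' | ⟨-, h'⟩); exacts [hik h', hmem h']), if_neg hmem]
          push_cast
          omega

theorem RunInv.step_zero {p : Fin n → ℕ} {u : List (Fin n × ℕ)} {P : Fin n → ℤ}
    {O : List (Fin n)} (h : RunInv S p u P O) {k : Fin n} (hP : P k = 0)
    (hlast : ∀ i, k < i → P i ≠ 0) :
    RunInv S p (u ++ [(k, 0)]) (psiUpdate S P k 0) (psiAppend S O k 0) := by
  have hk := h.mem_iff (s := 0) (by simpa using hP)
  convert h.step (s := 0) (by simpa using hP) (Nat.zero_le _)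
    (fun i hi => ⟨rfl, not_lt.1 fun hlt => hlast i hlt hi⟩) (by intro r a hr; omega) using 1
  have h1 : u.filter (fun a => a.2 < maxShift S ∧ (a.1, a.2 + 1) ∉ u ++ [(k, 0)])
      = pending S u := by
    refine List.filter_congr fun a _ => ?_
    simp
  have h2 : (k, 0 + 1) ∉ u ++ [(k, 0)] := by simp [hk]
  rw [pending, List.filter_append, h1, List.map_append, psiAppend, h.queue]
  by_cases hm : 0 < maxShift S
  · rw [if_pos hm, List.filter_cons_of_pos (by simp only [decide_eq_true_eq]; exact ⟨hm, h2⟩)]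
    simp
  · rw [if_neg hm, List.filter_cons_of_neg (by simpa using fun h => absurd h hm)]
    simp

theorem RunInv.step_queue {p : Fin n → ℕ} {u : List (Fin n × ℕ)} {P : Fin n → ℤ} {k : Fin n}
    {O : List (Fin n)} (h : RunInv S p u P (k :: O)) (hP : ∀ i, P i ≠ 0) {s : ℕ}
    (hs : P k = -(s : ℤ)) :
    RunInv S p (u ++ [(k, s)]) (psiUpdate S P k s) (psiAppend S O k s) := by
  have hk := h.mem_iff hs
  obtain ⟨a, F, hF, rfl, hO⟩ := List.map_eq_cons_iff.1 h.queue.symm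
  obtain ⟨l1, l2, hu, hl1, ha, hl2⟩ := List.filter_eq_cons_iff.1 hF
  obtain ⟨k, q⟩ := a
  simp only at hs hk hO ⊢
  simp only [decide_eq_true_eq] at ha hl1
  have hkq : (k, q) ∈ u := by rw [hu]; simp
  obtain rfl : s = q + 1 := by
    have h1 := (hk q).1 hkq
    have h2 := ha.2
    rw [hk] at h2
    omega
  have hn := h.nodup
  rw [hu] at hn
  convert h.step hs ha.1 (fun i hi => absurd hi (hP i)) ?_ using 1
  · have e1 : l1.filter (fun a => a.2 < maxShift S ∧ (a.1, a.2 + 1) ∉ u ++ [(k, q + 1)]) = [] := by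
      rw [List.filter_eq_nil_iff]
      intro b hb
      have := hl1 b hb
      simp only [decide_eq_true_eq]
      rintro ⟨h3, h4⟩
      exact this ⟨h3, fun h5 => h4 (List.mem_append_left _ h5)⟩
    have e2 : l2.filter (fun a => a.2 < maxShift S ∧ (a.1, a.2 + 1) ∉ u ++ [(k, q + 1)]) = F := by
      rw [← hl2]
      refine List.filter_congr fun b hb => ?_
      have hne : b ≠ (k, q) := by
        rintro rfl
        exact (List.nodup_cons.1 (List.nodup_append.1 hn).2.1).1 hb
      have hne' : ¬ (b.1 = k ∧ b.2 = q) := fun h => hne (Prod.ext h.1 h.2)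
      simp only [List.mem_append, List.mem_singleton, Prod.mk.injEq, Nat.add_right_cancel_iff,
        hne', or_false]
    have e3 : (k, q + 1 + 1) ∉ u ++ [(k, q + 1)] := by simp [hk]
    have e4 : pending S (u ++ [(k, q + 1)]) = F ++
        [(k, q + 1)].filter (fun a => a.2 < maxShift S ∧ (a.1, a.2 + 1) ∉ u ++ [(k, q + 1)]) := by
      rw [pending, List.filter_append]
      congr 1
      conv_lhs => rw [hu]
      rw [List.filter_append, ← hu, e1, List.nil_append, List.filter_cons_of_neg, e2]
      simp
    rw [e4, List.map_append, hO, psiAppend]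
    by_cases hm : q + 1 < maxShift S
    · rw [if_pos hm, List.filter_cons_of_pos (by simp only [decide_eq_true_eq]; exact ⟨hm, e3⟩)]
      simp
    · rw [if_neg hm, List.filter_cons_of_neg (by simpa using fun h => absurd h hm)]
      simp
  · intro r b hr hb hbm
    obtain rfl : q = r := by omega
    rw [hu] at hb
    by_contra hc
    exact hl1 b (hb.mem_of_nodup hn) ⟨hbm, hc⟩

theorem RunInv.length_le {p : Fin n → ℕ} {u : List (Fin n × ℕ)} {P : Fin n → ℤ}
    {O : List (Fin n)} (h : RunInv S p u P O) : u.length ≤ (maxShift S + 1) * n := by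
  rw [← List.toFinset_card_of_nodup h.nodup]
  calc u.toFinset.card ≤ (Finset.univ ×ˢ Finset.range (maxShift S + 1) :
        Finset (Fin n × ℕ)).card := by
        refine Finset.card_le_card fun a ha => ?_
        simpa [Nat.lt_succ_iff] using h.le a (List.mem_toFinset.1 ha)
    _ = (maxShift S + 1) * n := by
        rw [Finset.card_product]
        simp [mul_comm]

/-- The process terminates from any `p`, since no letter is written twice and only `(maxShift S + 1)
* n` letters are available. -/
theorem RunInv.exists_run {p : Fin n → ℕ} (N : ℕ) : ∀ (u : List (Fin n × ℕ)) (P : Fin n → ℤ)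
    (O : List (Fin n)), RunInv S p u P O → (maxShift S + 1) * n - u.length = N →
      ∃ v, PsiRun S P O v := by
  induction N using Nat.strong_induction_on with
  | _ N ih =>
    intro u P O h hN
    have next : ∀ {c : Fin n × ℕ} {P' : Fin n → ℤ} {O' : List (Fin n)},
        RunInv S p (u ++ [c]) P' O' → ∃ v, PsiRun S P' O' v := by
      intro c P' O' h'
      have hlen := h'.length_le
      rw [List.length_append, List.length_singleton] at hlen
      refine ih _ ?_ _ _ _ h' rfl
      rw [List.length_append, List.length_singleton]
      omega
    by_cases hz : ∃ k, P k = 0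
    · obtain ⟨k, hk, hmax⟩ := (Set.toFinite {k | P k = 0}).exists_maximalFor id _ hz
      have hlast : ∀ i, k < i → P i ≠ 0 := fun i hi h0 => (hmax (j := i) h0 hi.le).not_gt hi
      obtain ⟨v, hv⟩ := next (h.step_zero hk hlast)
      exact ⟨_, .zero P O k v hk hlast hv⟩
    · push Not at hz
      rcases O with _ | ⟨k, O⟩
      · exact ⟨[], .halt P hz⟩
      · have hneg : ∃ s : ℕ, P k = -(s : ℤ) := by
          obtain ⟨a, F, hF, rfl, hO⟩ := List.map_eq_cons_iff.1 h.queue.symm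
          have ha : a ∈ u := List.mem_of_mem_filter (p := fun a => a.2 < maxShift S ∧
            (a.1, a.2 + 1) ∉ u) (by rw [← pending, hF]; exact List.mem_cons_self)
          obtain ⟨c, h1, h2, -⟩ := h.letters a.1
          have := (h1 a.2).1 ha
          exact ⟨c, h2 (by omega)⟩
        obtain ⟨s, hs⟩ := hneg
        obtain ⟨v, hv⟩ := next (h.step_queue hz hs)
        exact ⟨_, .queue P k O s v hz hs hv⟩

theorem RunInv.of_run {p : Fin n → ℕ} {P : Fin n → ℤ} {O : List (Fin n)}
    {v : List (Fin n × ℕ)} (hrun : PsiRun S P O v) : ∀ u, RunInv S p u P O →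
      ∃ P', (∀ i, P' i ≠ 0) ∧ RunInv S p (u ++ v) P' [] := by
  induction hrun with
  | halt P hP => exact fun u h => ⟨P, hP, by rwa [List.append_nil]⟩
  | zero P O k w hk hlast _ ih =>
    intro u h
    simpa using ih _ (h.step_zero hk hlast)
  | queue P k O s w hP hs _ ih =>
    intro u h
    simpa using ih _ (h.step_queue hP hs)

/-- With an empty list, every index that has started is complete. If the set `U` of unstarted
indices were non-empty, the parking condition would give `a ∈ U` with `p a` at most the number of
arcs to started indices, which is `cnt S a u`. Then `P a = 0`, and the process could not have
stopped. -/
theorem RunInv.mem_iff_of_halt {p : Fin n → ℕ} (hp : p ∈ Park S) {u : List (Fin n × ℕ)}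
    {P : Fin n → ℤ} (h : RunInv S p u P []) (hP : ∀ i, P i ≠ 0) (i : Fin n) (r : ℕ) :
    (i, r) ∈ u ↔ r ≤ maxShift S := by
  have hstart : ∀ i, (i, 0) ∈ u → ∀ r, (i, r) ∈ u ↔ r ≤ maxShift S := by
    intro i hi r
    obtain ⟨c, h1, -, -⟩ := h.letters i
    have hc := (h1 0).1 hi
    have hnil : pending S u = [] := List.map_eq_nil_iff.1 h.queue.symm
    have h2 := List.filter_eq_nil_iff.1 hnil (i, c - 1) ((h1 _).2 (by omega))
    simp only [decide_eq_true_eq, not_and, not_not] at h2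
    have h3 := h.le _ ((h1 (c - 1)).2 (by omega))
    simp only at h3
    have h4 : ¬ c - 1 < maxShift S := fun hlt => by
      have := (h1 _).1 (h2 hlt)
      omega
    rw [h1]
    omega
  refine hstart i ?_ r
  by_contra hi
  obtain ⟨a, ha, hlt⟩ := hp (Finset.univ.filter fun i => (i, 0) ∉ u) ⟨i, by simpa using hi⟩
  rw [Finset.mem_filter] at ha
  obtain ⟨c, h1, h2, h3⟩ := h.letters a
  obtain ⟨h4, h5⟩ := h3 (by
    by_contra hc
    exact ha.2 ((h1 0).2 (by omega)))
  have hPa := hP a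
  rw [sum_multigraph, ← card_filter_plusSet] at hlt
  have : cnt S a u = ((Finset.univ ×ˢ Finset.range (maxShift S + 1)).filter
      fun q : Fin n × ℕ => q.1 ∈ (Finset.univ.filter
        fun v => v ∉ Finset.univ.filter fun i => (i, 0) ∉ u) ∧ q.2 ∈ plusSet S a q.1).card := by
    rw [cnt_eq_card h.nodup]
    congr 1
    ext ⟨j, s⟩
    simp only [Finset.mem_filter, List.mem_toFinset, Finset.mem_product, Finset.mem_univ,
      true_and, not_not, Finset.mem_range, Nat.lt_succ_iff]
    constructor
    · rintro ⟨hm, hS⟩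
      have h0 : (j, 0) ∈ u := by
        obtain ⟨c, h1, -, -⟩ := h.letters j
        have := (h1 s).1 hm
        exact (h1 0).2 (by omega)
      exact ⟨h.le _ hm, h0, hS⟩
    · rintro ⟨hs, h0, hS⟩
      exact ⟨(hstart j h0 s).2 hs, hS⟩
  omega

theorem isSketch_of_run {p : Fin n → ℕ} (hp : p ∈ Park S) {w : List (Fin n × ℕ)}
    (hrun : PsiRun S (fun i => (p i : ℤ)) [] w) : w ∈ setM S ∧ Follows S p w := by
  obtain ⟨P, hP, h⟩ := RunInv.of_run hrun [] (RunInv.start p)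
  rw [List.nil_append] at h
  have hmem := h.mem_iff_of_halt hp hP
  refine ⟨⟨⟨?_, hmem, ?_, ?_⟩, h.adj⟩, h.follows⟩
  · have h1 : w.toFinset = Finset.univ ×ˢ Finset.range (maxShift S + 1) := by
      ext ⟨i, s⟩
      simp [hmem]
    rw [← List.toFinset_card_of_nodup h.nodup, h1, Finset.card_product]
    simp [mul_comm]
  · intro i s h1 h2
    obtain ⟨r, rfl⟩ : ∃ r, s = r + 1 := ⟨s - 1, by omega⟩
    exact h.pred i r ((hmem i _).2 h2)
  · intro i j s t hs hsm ht htm hb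
    obtain ⟨s, rfl⟩ : ∃ r, s = r + 1 := ⟨s - 1, by omega⟩
    obtain ⟨t, rfl⟩ : ∃ r, t = r + 1 := ⟨t - 1, by omega⟩
    exact h.fifo _ _ hb ((hmem _ _).2 htm) hsm

theorem exists_run (p : Fin n → ℕ) : ∃ w, PsiRun S (fun i => (p i : ℤ)) [] w :=
  RunInv.exists_run _ [] _ _ (RunInv.start p) rfl

theorem setN_subset_setM : setN S ⊆ setM S := fun _ ⟨_, hp, hrun⟩ => (isSketch_of_run hp hrun).1

/-! ### Realization of sketches by points -/

/-- Read the word from left to right, keeping the value of every pending successor above all values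
already used. A letter `α_k^0` receives a value in the gap; a later letter has a prescribed value,
and the shift axiom ensures that it is the lowest pending one. -/
theorem IsSketch.exists_point {m : ℕ} {w : List (Fin n × ℕ)} (hw : IsSketch m w) :
    ∃ x : Fin n → ℝ, ∀ a b, Before w a b → x a.1 + a.2 < x b.1 + b.2 := by
  have hn := hw.nodup
  suffices key : ∀ u v, w = u ++ v → ∃ x : Fin n → ℝ,
      (∀ a b, Before u a b → x a.1 + a.2 < x b.1 + b.2) ∧
      ∀ a ∈ u, ∀ b ∈ u, b.2 < m → (b.1, b.2 + 1) ∉ u → x a.1 + a.2 < x b.1 + b.2 + 1 by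
    obtain ⟨x, hx, -⟩ := key w [] (by simp)
    exact ⟨x, hx⟩
  intro u
  induction u using List.reverseRecOn with
  | nil =>
    intro v _
    exact ⟨0, fun a b h => by simpa using h.right_mem, by simp⟩
  | append_singleton u c ih =>
    obtain ⟨k, s⟩ := c
    intro v he
    have he' : w = u ++ (k, s) :: v := by simpa using he
    obtain ⟨x, hx1, hx2⟩ := ih _ he'
    have hnot : (k, s) ∉ u := by
      rw [he'] at hn
      exact fun hm => (List.nodup_append.1 hn).2.2 _ hm _ (by simp) rfl
    have hs : s ≤ m := (hw.mem_iff k s).1 (by rw [he']; simp)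
    rcases s with _ | r
    · have hk : ∀ a ∈ u, a.1 ≠ k := by
        rintro ⟨k', s'⟩ ha rfl
        exact hnot (hw.zero_mem he' ha)
      obtain ⟨y, hy1, hy2⟩ := Order.exists_between_finsets
        (u.toFinset.image fun a => x a.1 + (a.2 : ℝ))
        ((u.toFinset.filter fun b => b.2 < m ∧ (b.1, b.2 + 1) ∉ u).image
          fun b => x b.1 + (b.2 : ℝ) + 1) (by
            intro z hz z' hz'
            obtain ⟨a, ha, rfl⟩ := Finset.mem_image.1 hz
            obtain ⟨b, hb, rfl⟩ := Finset.mem_image.1 hz'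
            rw [Finset.mem_filter] at hb
            exact hx2 a (List.mem_toFinset.1 ha) b (List.mem_toFinset.1 hb.1) hb.2.1 hb.2.2)
      have hlow : ∀ a ∈ u, x a.1 + a.2 < y := fun a ha =>
        hy1 _ (Finset.mem_image_of_mem _ (List.mem_toFinset.2 ha))
      have hup : ∀ b ∈ u, b.2 < m → (b.1, b.2 + 1) ∉ u → y < x b.1 + b.2 + 1 := fun b hb h1 h2 =>
        hy2 _ (Finset.mem_image_of_mem _
          (Finset.mem_filter.2 ⟨List.mem_toFinset.2 hb, h1, h2⟩))
      have hold : ∀ a ∈ u, Function.update x k y a.1 = x a.1 := fun a ha =>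
        Function.update_of_ne (hk a ha) _ _
      refine ⟨Function.update x k y, ?_, ?_⟩
      · intro a b hab
        rcases before_append_singleton.1 hab with hab | ⟨ha, rfl⟩
        · rw [hold a hab.left_mem, hold b hab.right_mem]
          exact hx1 a b hab
        · rw [hold a ha, Function.update_self]
          simpa using hlow a ha
      · intro a ha b hb hbm hbs
        have hbs' : (b.1, b.2 + 1) ∉ u := fun h => hbs (List.mem_append_left _ h)
        simp only [List.mem_append, List.mem_singleton] at ha hb
        rcases ha with ha | rfl <;> rcases hb with hb | rfl
        · rw [hold a ha, hold b hb]
          exact hx2 a ha b hb hbm hbs'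
        · rw [hold a ha, Function.update_self]
          have := hlow a ha
          push_cast
          linarith
        · rw [hold b hb, Function.update_self]
          have := hup b hb hbm hbs'
          push_cast
          linarith
        · linarith
    · have hr : (k, r) ∈ u := hw.pred_mem he'
      refine ⟨x, ?_, ?_⟩
      · intro a b hab
        rcases before_append_singleton.1 hab with hab | ⟨ha, rfl⟩
        · exact hx1 a b hab
        · have := hx2 a ha _ hr (by simpa using hs) hnot
          push_cast
          linarith
      · intro a ha b hb hbm hbs
        have hbs' : (b.1, b.2 + 1) ∉ u := fun h => hbs (List.mem_append_left _ h)
        simp only [List.mem_append, List.mem_singleton] at ha hb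
        rcases ha with ha | rfl <;> rcases hb with hb | rfl
        · exact hx2 a ha b hb hbm hbs'
        · have := hx2 a ha _ hr (by simpa using hs) hnot
          push_cast
          linarith
        · have hne : (k, r) ≠ b := by
            rintro rfl
            simp at hbs
          rcases before_or_before hr hb hne with h | h
          · have := hx1 _ _ h
            push_cast
            linarith
          · exfalso
            have h' : Before w b (k, r) := by rw [he']; exact h.append _
            have := hw.before_shift b.1 k (b.2 + 1) (r + 1) (by omega) hbm (by omega) hs h'
            rw [he'] at this hn
            exact hbs' (this.mem_of_nodup hn)
        · linarith

theorem lt_iff_before {w : List (Fin n × ℕ)} {x : Fin n → ℝ}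
    (hx : ∀ a b, Before w a b → x a.1 + a.2 < x b.1 + b.2) {a b : Fin n × ℕ}
    (ha : a ∈ w) (hb : b ∈ w) : x a.1 + a.2 < x b.1 + b.2 ↔ Before w a b := by
  refine ⟨fun hlt => ?_, hx a b⟩
  by_cases hab : a = b
  · subst hab; exact absurd hlt (lt_irrefl _)
  · exact (before_or_before ha hb hab).resolve_right fun h => hlt.not_gt (hx b a h)

theorem IsSketch.point_mem_arrCompl {w : List (Fin n × ℕ)} (hw : IsSketch (maxShift S) w)
    {x : Fin n → ℝ} (hx : ∀ a b, Before w a b → x a.1 + a.2 < x b.1 + b.2) :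
    x ∈ arrCompl S := by
  rw [mem_arrCompl_iff]
  intro i j s hs he
  have hne : (j, s) ≠ (i, 0) := fun h => ne_of_mem_plusSet hs (congrArg Prod.fst h).symm
  rcases before_or_before ((hw.mem_iff j s).2 (le_maxShift hs))
    ((hw.mem_iff i 0).2 (Nat.zero_le _)) hne with h | h
  · have := hx _ _ h
    push_cast at this
    linarith
  · have := hx _ _ h
    push_cast at this
    linarith

theorem IsSketch.card_crossed {w : List (Fin n × ℕ)} (hw : IsSketch (maxShift S) w)
    {x : Fin n → ℝ} (hx : ∀ a b, Before w a b → x a.1 + a.2 < x b.1 + b.2) (i : Fin n) :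
    (crossed S x i).card = wordLabel S w i := by
  have h0 : (i, 0) ∈ w := (hw.mem_iff i 0).2 (Nat.zero_le _)
  obtain ⟨u, v, he⟩ := List.append_of_mem h0
  have hn := hw.nodup
  rw [wordLabel_eq hn he]
  have hnu : u.Nodup := by
    rw [he] at hn
    exact (List.nodup_append.1 hn).1
  rw [cnt_eq_card hnu]
  congr 1
  ext q
  rw [mem_crossed, Finset.mem_filter, List.mem_toFinset, and_comm]
  refine and_congr_left fun hq => ?_
  have hqw : q ∈ w := (hw.mem_iff q.1 q.2).2 (le_maxShift hq)
  have := lt_iff_before hx hqw h0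
  simp only [Nat.cast_zero, add_zero] at this
  rw [this]
  rw [he] at hn ⊢
  exact ⟨fun h => h.mem_of_nodup hn, fun h => before_iff.2 ⟨u, v, rfl, h⟩⟩

/-! ### Surjectivity of the labeling, and comparison of `M` with `N` -/

theorem IsSketch.wordLabel_mem_park {w : List (Fin n × ℕ)} (hw : IsSketch (maxShift S) w) :
    wordLabel S w ∈ Park S := by
  obtain ⟨x, hx⟩ := hw.exists_point
  rw [← funext (hw.card_crossed hx)]
  exact crossed_card_mem_park x

theorem Follows.wordLabel_eq {m : ℕ} {w : List (Fin n × ℕ)} (hw : IsSketch m w) {p : Fin n → ℕ}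
    (h : Follows S p w) : wordLabel S w = p := by
  funext i
  obtain ⟨u, v, he⟩ := List.append_of_mem ((hw.mem_iff i 0).2 (Nat.zero_le _))
  rw [SBraid.wordLabel_eq hw.nodup he]
  exact (h u _ v he).1 rfl

theorem surjOn_gpsLabel : Set.SurjOn (gpsLabel S) (regions S) (Park S) := by
  intro p hp
  obtain ⟨w, hrun⟩ := exists_run (S := S) p
  obtain ⟨⟨hw, -⟩, hfol⟩ := isSketch_of_run hp hrun
  obtain ⟨x, hx⟩ := hw.exists_point
  have hxc := hw.point_mem_arrCompl hx
  refine ⟨_, ⟨x, hxc, rfl⟩, ?_⟩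
  funext i
  rw [gpsLabel_eq hxc, hw.card_crossed hx, hfol.wordLabel_eq hw]

/-- Both `w` and the output of `Ψ` on its label follow that label, so they coincide. -/
theorem PropertyX.setM_subset_setN (hX : PropertyX S) : setM S ⊆ setN S := by
  intro w hw
  have hp := hw.1.wordLabel_mem_park
  obtain ⟨w', hrun⟩ := exists_run (S := S) (wordLabel S w)
  obtain ⟨hw', hfol⟩ := isSketch_of_run hp hrun
  rw [hw.1.eq_of_follows hw'.1 (hX.follows hw) hfol]
  exact ⟨_, hp, hrun⟩

theorem IsSketch.fst_ne_of_followedBy {m : ℕ} {w : List (Fin n × ℕ)} (hw : IsSketch m w)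
    {i j : Fin n} {s : ℕ} (h : FollowedBy w (j, s) (i, 0)) : j ≠ i := by
  rintro rfl
  obtain ⟨u, v, he⟩ := followedBy_iff.1 h
  have hn := hw.nodup
  have h0 := hw.zero_mem (u := u ++ [(j, s)]) (v := (j, 0) :: v) (k := j) (s := s)
    (by simpa using he) (by simp)
  have he' : w = (u ++ [(j, s)]) ++ (j, 0) :: v := by simpa using he
  rw [he'] at hn
  exact (List.nodup_append.1 hn).2.2 _ h0 _ (by simp) rfl

theorem setM_subset_setL : setM S ⊆ setL S := fun _ hw => ⟨hw.1, fun i j s h _ => hw.2 i j s h⟩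

/-- If `(i,j,s)` fails to be a triple, `s` is not maximal for `j`. The maximal `s'` is then positive
and lies in some `S_{i',j}^+`, which (Y) forbids since `s' > s`. -/
theorem PropertyY.setL_subset_setM (hY : PropertyY S) : setL S ⊆ setM S := by
  rintro w ⟨hw, hL⟩
  refine ⟨hw, fun i j s h => ?_⟩
  by_contra hT
  have hs : 0 < s ∨ j < i := by
    rcases Nat.eq_zero_or_pos s with rfl | h0
    · exact Or.inr (lt_of_le_of_ne (not_lt.1 fun hij => hT (Or.inr ⟨rfl, hij⟩))
        (hw.fst_ne_of_followedBy h))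
    · exact Or.inl h0
  have hbound : ∀ i' s', FollowedBy w (j, s') (i', 0) → s' ≤ maxShift S := by
    intro i' s' h'
    obtain ⟨u, v, he⟩ := followedBy_iff.1 h'
    exact (hw.mem_iff j s').1 (by rw [he]; simp)
  have hfin : {s' | ∃ i', FollowedBy w (j, s') (i', 0)}.Finite :=
    (Set.finite_Iic (maxShift S)).subset fun s' ⟨i', h'⟩ => hbound i' s' h'
  obtain ⟨s', ⟨i', h'⟩, hmax⟩ := hfin.exists_maximalFor id _ ⟨s, i, h⟩
  have hmax' : ∀ i'' s'', FollowedBy w (j, s'') (i'', 0) → s'' ≤ s' := by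
    intro i'' s'' h''
    by_contra hlt
    exact hlt (hmax (j := s'') ⟨i'', h''⟩ (by simpa using (not_le.1 hlt).le))
  have hT' := hL i' j s' h' hmax'
  have hss := hmax' i s h
  have hlt : s < s' := by
    refine lt_of_le_of_ne hss fun he => hT ?_
    subst he
    obtain ⟨u, v, e1⟩ := followedBy_iff.1 h
    obtain ⟨u', v', e2⟩ := followedBy_iff.1 h'
    have hn := hw.nodup
    rw [e1] at hn e2
    have := (append_cons_inj_of_nodup hn e2).2
    simp only [List.cons.injEq, Prod.mk.injEq, and_true] at this
    rwa [this.1]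
  have hii : i' ≠ i := by
    rintro rfl
    obtain ⟨u, v, e1⟩ := followedBy_iff.1 h
    obtain ⟨u', v', e2⟩ := followedBy_iff.1 h'
    have e1' : w = (u ++ [(j, s)]) ++ (i', 0) :: v := by simpa using e1
    have e2' : w = (u' ++ [(j, s')]) ++ (i', 0) :: v' := by simpa using e2
    have hn := hw.nodup
    rw [e1'] at hn e2'
    have := (append_cons_inj_of_nodup hn e2').1
    have := congrArg List.getLast? this
    simp at this
    omega
  rcases hT' with hT' | ⟨h0, -⟩
  · obtain ⟨t, rfl⟩ := Nat.exists_eq_add_of_lt hlt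
    refine hY i j i' (hw.fst_ne_of_followedBy h).symm (hw.fst_ne_of_followedBy h').symm hii s hs
      (fun h => hT (Or.inl h)) (t + 1) (by omega) ?_
    rwa [← add_assoc]
  · omega

/-! ### Explicit sketches -/

theorem exists_list_sorted_by {α : Type} {β : Type*} [DecidableEq α] [LinearOrder β] (f : α → β)
    (s : Finset α) : ∃ l : List α, l.toFinset = s ∧ l.Nodup ∧ ∀ a b, Before l a b → f a ≤ f b := by
  induction s using Finset.induction_on_max_value f with
  | empty => exact ⟨[], rfl, List.nodup_nil, fun a b h => by simpa using h.right_mem⟩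
  | insert a s ha hmax ih =>
    obtain ⟨l, rfl, hl, hs⟩ := ih
    refine ⟨l ++ [a], ?_, ?_, ?_⟩
    · ext b
      simp
    · rw [List.nodup_append]
      refine ⟨hl, List.nodup_singleton a, ?_⟩
      intro b hb c hc hbc
      rw [List.mem_singleton] at hc
      subst hc hbc
      exact ha (List.mem_toFinset.2 hb)
    · intro b c hbc
      rcases before_append_singleton.1 hbc with h | ⟨h, rfl⟩
      · exact hs b c h
      · exact hmax b (List.mem_toFinset.2 h)

theorem followedBy_iff_before {α : Type} {w : List α} (hw : w.Nodup) {a b : α} :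
    FollowedBy w a b ↔ Before w a b ∧ ∀ c, ¬ (Before w a c ∧ Before w c b) := by
  constructor
  · intro h
    obtain ⟨u, v, rfl⟩ := followedBy_iff.1 h
    refine ⟨before_iff.2 ⟨u ++ [a], v, by simp, by simp⟩, ?_⟩
    rintro c ⟨h1, h2⟩
    have e : u ++ a :: b :: v = (u ++ [a]) ++ b :: v := by simp
    have hw' := hw
    have h2' := h2
    rw [e] at hw' h2'
    rcases List.mem_append.1 (h2'.mem_of_nodup hw') with h3 | h3
    · exact h1.asymm_of_nodup hw (before_iff.2 ⟨u, b :: v, rfl, h3⟩)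
    · rw [List.mem_singleton] at h3
      subst h3
      exact h1.asymm_of_nodup hw h1
  · rintro ⟨h, hno⟩
    obtain ⟨u, v, rfl, ha⟩ := before_iff.1 h
    obtain ⟨u1, u2, rfl⟩ := List.append_of_mem ha
    rcases u2 with _ | ⟨c, u2⟩
    · exact followedBy_iff.2 ⟨u1, v, by simp⟩
    · exact absurd ⟨before_iff.2 ⟨u1 ++ [a], u2 ++ b :: v, by simp, by simp⟩,
        before_iff.2 ⟨u1 ++ a :: c :: u2, v, rfl, by simp⟩⟩ (hno c)

theorem FollowedBy.left_unique {α : Type} {w : List α} (hw : w.Nodup) {a b c : α}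
    (h : FollowedBy w a c) (h' : FollowedBy w b c) : a = b := by
  obtain ⟨u, v, e1⟩ := followedBy_iff.1 h
  obtain ⟨u', v', e2⟩ := followedBy_iff.1 h'
  have e1' : w = (u ++ [a]) ++ c :: v := by simpa using e1
  have e2' : w = (u' ++ [b]) ++ c :: v' := by simpa using e2
  rw [e1'] at hw e2'
  simpa using congrArg List.getLast? (append_cons_inj_of_nodup hw e2').1

/-- The order of the letters `α_i^s` according to the numbers `h i + s`, with ties broken by
`g`. -/
def LetterLT (h : Fin n → ℕ) (g : Fin n → ℤ) (a b : Fin n × ℕ) : Prop :=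
  a.2 + h a.1 < b.2 + h b.1 ∨ (a.2 + h a.1 = b.2 + h b.1 ∧ g a.1 < g b.1)

/-- Adding `1` to both exponents preserves `LetterLT`, so sorting the letters by it gives a sketch.
Adjacency becomes the covering relation of this order. -/
theorem exists_sketch (m : ℕ) (h : Fin n → ℕ) (g : Fin n → ℤ) (hg : Function.Injective g) :
    ∃ w, IsSketch m w ∧ ∀ a b, FollowedBy w a b ↔ a.2 ≤ m ∧ b.2 ≤ m ∧ LetterLT h g a b ∧
      ∀ c : Fin n × ℕ, c.2 ≤ m → ¬ (LetterLT h g a c ∧ LetterLT h g c b) := by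
  set f : Fin n × ℕ → ℕ ×ₗ ℤ := fun a => toLex (a.2 + h a.1, g a.1) with hf
  have hlt : ∀ a b, f a < f b ↔ LetterLT h g a b := fun a b => Prod.Lex.toLex_lt_toLex
  have hinj : Function.Injective f := by
    intro a b hab
    have hab := Prod.mk.injEq _ _ _ _ ▸ toLex.injective hab
    obtain ⟨a1, a2⟩ := a
    obtain ⟨b1, b2⟩ := b
    obtain ⟨h1, h2⟩ := hab
    obtain rfl := hg h2
    simp only at h1
    rw [Prod.mk.injEq]
    exact ⟨rfl, by omega⟩
  obtain ⟨w, hw, hn, hs⟩ := exists_list_sorted_by f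
    (Finset.univ ×ˢ Finset.range (m + 1) : Finset (Fin n × ℕ))
  have hmem : ∀ a, a ∈ w ↔ a.2 ≤ m := by
    intro a
    rw [← List.mem_toFinset, hw]
    simp
  have hbef : ∀ a b, Before w a b ↔ a.2 ≤ m ∧ b.2 ≤ m ∧ LetterLT h g a b := by
    intro a b
    rw [← hmem, ← hmem, ← hlt]
    constructor
    · intro hab
      refine ⟨hab.left_mem, hab.right_mem, lt_of_le_of_ne (hs a b hab) fun he => ?_⟩
      have := hinj he
      subst this
      exact hab.asymm_of_nodup hn hab
    · rintro ⟨ha, hb, hl⟩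
      have hne : a ≠ b := by
        rintro rfl
        exact lt_irrefl _ hl
      exact (before_or_before ha hb hne).resolve_right fun h' => (hs b a h').not_gt hl
  refine ⟨w, ⟨?_, fun i s => hmem (i, s), ?_, ?_⟩, fun a b => ?_⟩
  · rw [← List.toFinset_card_of_nodup hn, hw, Finset.card_product]
    simp [mul_comm]
  · intro i s h1 h2
    exact (hbef _ _).2 ⟨by simp only; omega, h2, Or.inl (by simp only; omega)⟩
  · intro i j s t h1 h2 h3 h4 hb
    refine (hbef _ _).2 ⟨h2, h4, ?_⟩
    rcases ((hbef _ _).1 hb).2.2 with h5 | ⟨h5, h6⟩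
    · simp only at h5
      exact Or.inl (by simp only; omega)
    · simp only at h5
      exact Or.inr ⟨by simp only; omega, h6⟩
  · rw [followedBy_iff_before hn]
    simp only [hbef]
    constructor
    · rintro ⟨⟨h1, h2, h3⟩, h4⟩
      exact ⟨h1, h2, h3, fun c hc h5 => h4 c ⟨⟨h1, hc, h5.1⟩, hc, h2, h5.2⟩⟩
    · rintro ⟨h1, h2, h3, h4⟩
      exact ⟨⟨h1, h2, h3⟩, fun c h5 => h4 c h5.1.2.1 ⟨h5.1.2.2, h5.2.2.2⟩⟩

/-- A violation of (Y) yields a sketch in `L` outside `M`: `α_i^0` directly follows `α_j^s`, which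
is no triple, but `α_k^0` directly follows `α_j^{s+t}`, a triple with a larger exponent that hides
the first. -/
theorem propertyY_of_setL_subset_setM (hLM : setL S ⊆ setM S) : PropertyY S := by
  intro i j k hij hkj hki s hs hn t ht hmem
  have hm := le_maxShift hmem
  set h : Fin n → ℕ := fun a => if a = i then s else if a = k then s + t else 0 with hh
  -- The factor `3` leaves two free slots after `j`, used by `k` and `i`. The sign places larger
  -- indices first, so that the remaining adjacencies, between letters of exponent `0`, are triples.
  set g : Fin n → ℤ := fun a => if a = i then -3 * (j : ℤ) + 2 else
    if a = k then -3 * (j : ℤ) + 1 else -3 * (a : ℤ) with hg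
  have hi : h i = s := by simp [hh]
  have hk : h k = s + t := by simp [hh, hki]
  have ho : ∀ a, a ≠ i → a ≠ k → h a = 0 := fun a h1 h2 => by simp [hh, h1, h2]
  have gi : g i = -3 * (j : ℤ) + 2 := by simp [hg]
  have gk : g k = -3 * (j : ℤ) + 1 := by simp [hg, hki]
  have go : ∀ a, a ≠ i → a ≠ k → g a = -3 * (a : ℤ) := fun a h1 h2 => by simp [hg, h1, h2]
  have hinj : Function.Injective g := by
    intro a b hab
    simp only [hg] at hab
    split_ifs at hab <;> omega
  obtain ⟨w, hw, hfol⟩ := exists_sketch (maxShift S) h g hinj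
  have hjs : FollowedBy w (j, s) (i, 0) := by
    refine (hfol _ _).2 ⟨by simp only; omega, Nat.zero_le _, Or.inr ⟨?_, ?_⟩, ?_⟩
    · simp only [hi, ho j hij.symm hkj.symm]; omega
    · simp only [gi, go j hij.symm hkj.symm]; omega
    · rintro ⟨b, r⟩ - ⟨h1, h2⟩
      simp only [LetterLT, hi, gi, ho j hij.symm hkj.symm, go j hij.symm hkj.symm] at h1 h2
      by_cases hbi : b = i
      · subst hbi; rw [hi, gi] at h1 h2; omega
      · by_cases hbk : b = k
        · subst hbk; rw [hk, gk] at h1 h2; omega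
        · rw [ho b hbi hbk, go b hbi hbk] at h1 h2; omega
  have hjst : FollowedBy w (j, s + t) (k, 0) := by
    refine (hfol _ _).2 ⟨hm, Nat.zero_le _, Or.inr ⟨?_, ?_⟩, ?_⟩
    · simp only [hk, ho j hij.symm hkj.symm]; omega
    · simp only [gk, go j hij.symm hkj.symm]; omega
    · rintro ⟨b, r⟩ - ⟨h1, h2⟩
      simp only [LetterLT, hk, gk, ho j hij.symm hkj.symm, go j hij.symm hkj.symm] at h1 h2
      omega
  have hnT : ¬ IsTriple S i j s := by
    rintro (h1 | ⟨h1, h2⟩)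
    · exact hn h1
    · rcases hs with h3 | h3
      · omega
      · exact absurd h2 h3.asymm
  refine hnT ((hLM (⟨hw, ?_⟩ : w ∈ setL S)).2 i j s hjs)
  intro i' j' r hf hmax
  by_cases h1 : i' = i
  · subst h1
    have := hf.left_unique hw.nodup hjs
    rw [Prod.mk.injEq] at this
    obtain ⟨rfl, rfl⟩ := this
    have := hmax k _ hjst
    omega
  by_cases h2 : i' = k
  · subst h2
    have := hf.left_unique hw.nodup hjst
    rw [Prod.mk.injEq] at this
    obtain ⟨rfl, rfl⟩ := this
    exact Or.inl hmem
  have h3 := ((hfol _ _).1 hf).2.2.1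
  simp only [LetterLT, ho i' h1 h2, go i' h1 h2] at h3
  obtain ⟨h4, h5⟩ := h3.resolve_left (by omega)
  obtain rfl : r = 0 := by omega
  refine Or.inr ⟨rfl, ?_⟩
  by_cases h6 : j' = i
  · subst h6
    rw [hi] at h4
    rw [gi] at h5
    have hji : j < j' := hs.resolve_left (by omega)
    rw [Fin.lt_def] at hji ⊢
    omega
  by_cases h7 : j' = k
  · subst h7
    rw [hk] at h4
    omega
  rw [go j' h6 h7] at h5
  rw [Fin.lt_def]
  omega

/-- A violation of (X) yields a sketch in `M` with consecutive letters `α_k^s`, `α_j^0`, `α_i^0`. If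
`Ψ` wrote it, the entry of `i` would be positive just before `α_k^s` and zero two letters later,
although neither of those letters lowers it. -/
theorem propertyX_of_setM_subset_setN (hMN : setM S ⊆ setN S) : PropertyX S := by
  intro i j k hij hki hkj s hs
  by_contra hn
  push Not at hn
  have hks : 1 ≤ s ∨ k < i := by
    rcases Nat.eq_zero_or_pos s with h | h
    · exact Or.inr (lt_of_le_of_ne (hn.2 h) hki)
    · exact Or.inl h
  have hm := le_maxShift hs
  set h : Fin n → ℕ := fun a => if a = i then s else if a = j then s else 0 with hh
  set g : Fin n → ℤ := fun a => if a = i then -3 * (k : ℤ) + 2 else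
    if a = j then -3 * (k : ℤ) + 1 else -3 * (a : ℤ) with hg
  have hi : h i = s := by simp [hh]
  have hj : h j = s := by simp [hh]
  have ho : ∀ a, a ≠ i → a ≠ j → h a = 0 := fun a h1 h2 => by simp [hh, h1, h2]
  have gi : g i = -3 * (k : ℤ) + 2 := by simp [hg]
  have gj : g j = -3 * (k : ℤ) + 1 := by simp [hg, hij.ne']
  have go : ∀ a, a ≠ i → a ≠ j → g a = -3 * (a : ℤ) := fun a h1 h2 => by simp [hg, h1, h2]
  have hinj : Function.Injective g := by
    intro a b hab
    simp only [hg] at hab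
    split_ifs at hab <;> omega
  obtain ⟨w, hw, hfol⟩ := exists_sketch (maxShift S) h g hinj
  have hkj' : FollowedBy w (k, s) (j, 0) := by
    refine (hfol _ _).2 ⟨hm, Nat.zero_le _, Or.inr ⟨?_, ?_⟩, ?_⟩
    · simp only [hj, ho k hki hkj]; omega
    · simp only [gj, go k hki hkj]; omega
    · rintro ⟨b, r⟩ - ⟨h1, h2⟩
      simp only [LetterLT, hj, gj, ho k hki hkj, go k hki hkj] at h1 h2
      omega
  have hji : FollowedBy w (j, 0) (i, 0) := by
    refine (hfol _ _).2 ⟨Nat.zero_le _, Nat.zero_le _, Or.inr ⟨?_, ?_⟩, ?_⟩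
    · simp only [hj, hi]
    · simp only [gj, gi]; omega
    · rintro ⟨b, r⟩ - ⟨h1, h2⟩
      simp only [LetterLT, hj, gj, hi, gi] at h1 h2
      omega
  have hwM : w ∈ setM S := by
    refine ⟨hw, fun i' j' r hf => ?_⟩
    by_cases h1 : i' = i
    · subst h1
      have := hf.left_unique hw.nodup hji
      rw [Prod.mk.injEq] at this
      obtain ⟨rfl, rfl⟩ := this
      exact Or.inr ⟨rfl, hij⟩
    by_cases h2 : i' = j
    · subst h2
      have := hf.left_unique hw.nodup hkj'
      rw [Prod.mk.injEq] at this
      obtain ⟨rfl, rfl⟩ := this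
      exact Or.inl hs
    have h3 := ((hfol _ _).1 hf).2.2.1
    simp only [LetterLT, ho i' h1 h2, go i' h1 h2] at h3
    obtain ⟨h4, h5⟩ := h3.resolve_left (by omega)
    obtain rfl : r = 0 := by omega
    refine Or.inr ⟨rfl, ?_⟩
    rw [Fin.lt_def] at hij hks ⊢
    by_cases h6 : j' = i
    · subst h6
      rw [hi] at h4
      rw [gi] at h5
      omega
    by_cases h7 : j' = j
    · subst h7
      rw [hj] at h4
      rw [gj] at h5
      omega
    rw [go j' h6 h7] at h5
    omega
  obtain ⟨p, hp, hrun⟩ := hMN hwM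
  have hfollows := (isSketch_of_run hp hrun).2
  obtain ⟨u, v, e1⟩ := followedBy_iff.1 hkj'
  obtain ⟨u', v', e2⟩ := followedBy_iff.1 hji
  have hnd := hw.nodup
  have e3 : v = (i, 0) :: v' := by
    have e1' : w = (u ++ [(k, s)]) ++ (j, 0) :: v := by simpa using e1
    rw [e1'] at hnd e2
    exact (append_cons_inj_of_nodup hnd e2).2
  rw [e3] at e1
  have hiu : (i, 0) ∉ u := by
    rw [e1] at hnd
    exact fun hmem => (List.nodup_append.1 hnd).2.2 _ hmem (i, 0) (by simp) rfl
  have h1 := (hfollows u _ _ e1).2 i hiu hks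
  have h2 := (hfollows (u ++ [(k, s), (j, 0)]) (i, 0) v' (by simpa using e1)).1 rfl
  have h3 : cnt S i [(k, s), (j, 0)] = 0 := by
    rw [cnt, List.countP_eq_zero]
    intro a ha
    simp only [List.mem_cons, List.not_mem_nil, or_false] at ha
    rw [decide_eq_true_eq]
    rcases ha with rfl | rfl
    · exact hn.1
    · intro h0
      rcases pos_or_lt_of_mem_plusSet h0 with h4 | h4
      · simp at h4
      · exact absurd h4 hij.asymm
  rw [cnt_append, h3] at h2
  simp only at h2
  omega

theorem words_eq_iff :
    (setN S = setL S ∧ setL S = setM S) ↔ PropertyX S ∧ PropertyY S := by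
  constructor
  · rintro ⟨h1, h2⟩
    exact ⟨propertyX_of_setM_subset_setN (h1.trans h2).ge, propertyY_of_setL_subset_setM h2.le⟩
  · rintro ⟨hX, hY⟩
    have h1 : setL S = setM S := hY.setL_subset_setM.antisymm setM_subset_setL
    exact ⟨h1 ▸ setN_subset_setM.antisymm hX.setM_subset_setN, h1⟩

theorem bijOn_gpsLabel_iff :
    Set.BijOn (gpsLabel S) (regions S) (Park S) ↔ Coherent S :=
  ⟨fun h => coherent_of_injOn h.injOn, fun h => ⟨mapsTo_gpsLabel, h.injOn, surjOn_gpsLabel⟩⟩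

end SBraid

theorem theorem5p1 (n : ℕ) (S : Fin n → Fin n → Finset ℤ) :
    ((SBraid.IsTransitive S ∨ (n ≠ 2 ∧ SBraid.IsTransitiveDistinct S)) →
      [ Set.BijOn (SBraid.gpsLabel S) (SBraid.regions S) (SBraid.Park S),
        SBraid.setN S = SBraid.setL S ∧ SBraid.setL S = SBraid.setM S,
        SBraid.PropertyX S ∧ SBraid.PropertyY S,
        SBraid.IsMEpsArrangement S ].TFAE) ∧
    (SBraid.IsMEpsArrangement S ↔
      SBraid.IsTransitive S ∧
        Set.BijOn (SBraid.gpsLabel S) (SBraid.regions S) (SBraid.Park S)) := by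
  have hac : SBraid.IsTransitiveDistinct S →
      Set.BijOn (SBraid.gpsLabel S) (SBraid.regions S) (SBraid.Park S) →
      SBraid.PropertyX S ∧ SBraid.PropertyY S := fun hT hbij =>
    have hZ := SBraid.bijOn_gpsLabel_iff.1 hbij
    ⟨SBraid.PropertyX.of_coherent hZ hT, SBraid.PropertyY.of_coherent hZ hT⟩
  refine ⟨fun hT => ?_, fun hd => ⟨hd.isTransitive, SBraid.bijOn_gpsLabel_iff.2 hd.coherent⟩,
    fun ⟨hT, hbij⟩ => ?_⟩
  · tfae_have 1 → 3 := hac (hT.elim SBraid.IsTransitive.distinct And.right)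
    tfae_have 2 ↔ 3 := SBraid.words_eq_iff
    -- This is the only implication in which the two alternative hypotheses are treated differently:
    -- the intervals come from repeated indices in one case and from a third index in the other.
    tfae_have 3 → 4 := fun ⟨hX, hY⟩ => SBraid.IsMEpsArrangement.of_propertyX_propertyY
      (hT.elim SBraid.IsTransitive.hasIntervals
        fun h => SBraid.HasIntervals.of_propertyX_propertyY h.1 hX hY) hX hY
    tfae_have 4 → 1 := fun hd => SBraid.bijOn_gpsLabel_iff.2 hd.coherent
    tfae_have 4 → 3 := fun hd => ⟨hd.propertyX, hd.propertyY⟩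
    tfae_finish
  · obtain ⟨hX, hY⟩ := hac hT.distinct hbij
    exact SBraid.IsMEpsArrangement.of_propertyX_propertyY hT.hasIntervals hX hY
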